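/- Consider two bosonic modes with annihilation operators $\hat a_1,\hat a_2$ on the two-mode Fock space $\mathcal H=\mathcal H_1\otimes\mathcal H_2$, and quadratures $\hat\xi=(\hat x_1,\hat p_1,\hat x_2,\hat p_2)$, $\hat x_k=(\hat a_k+\hat a_k^\dagger)/\sqrt2$, $\hat p_k=-i(\hat a_k-\hat a_k^\dagger)/\sqrt2$. For a density operator $\rho$ on $\mathcal H$ with finite mean particle number, the reduced state of the field (RSF) is the pair $(r,\alpha)$ with $$r_{kk'}=\operatorname{Tr}[\rho\,\hat a_{k'}^\dagger\hat a_k],\qquad \alpha_k=\operatorname{Tr}[\rho\,\hat a_k],$$ and $r_\alpha=r-|\alpha\rangle\langle\alpha|$ is its correlation matrix. Let $\xi_k=\operatorname{Tr}[\rho\,\hat\xi_k]$ be the first moments and $V_{\mathrm{cov}}$, with entries $\tfrac12\operatorname{Tr}[\rho\{\hat\xi_k,\hat\xi_l\}]-\xi_k\xi_l$, the covariance matrix. The state $\rho$ is Gaussian if it has finite mean particle number and $\operatorname{Tr}[\rho\,e^{i\eta\cdot\hat\xi}]=\exp(i\eta\cdot\xi-\tfrac12\eta^TV_{\mathrm{cov}}\eta)$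 for all $\eta\in\mathbb R^4$. A state is separable if it is a trace-norm limit of finite convex combinations of product states $\rho_1\otimes\rho_2$. The RSF contains no information about entanglement in two-mode Gaussian states, in the following sense. (i) For every two-mode Gaussian state $\rho$ there is a separable two-mode Gaussian state $\sigma$ with the same RSF as $\rho$. (ii) If moreover the covariance matrix of $\rho$ is in the standard form $$V_{\mathrm{sf}}(a,b,c_+,c_-)=\begin{bmatrix}a&0&c_+&0\\0&a&0&c_-\\c_+&0&b&0\\0&c_-&0&b\end{bmatrix},\qquad a,b,c_\pm\in\mathbb R,$$ then $c:=(r_\alpha)_{12}$ is real and $\sigma$ can be chosen with covariance matrix $V_{\mathrm{sf}}(a,b,c,c)$, that is, by replacing both $c_+$ and $c_-$ by $(r_\alpha)_{12}$. -/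

import Mathlib

open scoped InnerProductSpace

noncomputable section

namespace BosonField

/-! ### Fock space of two bosonic modes, in the occupation-number representation -/

/-- The Hilbert space `ℓ²(ι)`. A single mode has the Hilbert space `ℓ²(ℕ)`. -/
abbrev Ell2 (ι : Type) : Type := lp (fun _ : ι => ℂ) 2

/-- The Hilbert space of two modes, with orthonormal basis `|n₀, n₁⟩`; it is the Hilbert space
tensor product of two copies of `ℓ²(ℕ)` through `|n₀, n₁⟩ = |n₀⟩ ⊗ |n₁⟩`. -/
abbrev FockSpace : Type := Ell2 (Fin 2 → ℕ)

/-- The basis vector `|i⟩` of `ℓ²(ι)`. -/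
def ket {ι : Type} [DecidableEq ι] (i : ι) : Ell2 ι := lp.single 2 i (1 : ℂ)

/-- Finite linear combinations of the number states: the common invariant domain on which the
(unbounded) ladder and quadrature operators act. -/
abbrev FinVec : Type := (Fin 2 → ℕ) →₀ ℂ

/-- The inclusion of the finite linear combinations of number states into Fock space. -/
def toFock : FinVec →ₗ[ℂ] FockSpace := Finsupp.linearCombination ℂ ket

/-- Annihilation operator: `a_k |n⟩ = √n_k |n - e_k⟩`. -/
def annihilate (k : Fin 2) : Module.End ℂ FinVec :=
  Finsupp.linearCombination ℂ fun n : Fin 2 → ℕ =>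
    Finsupp.single (n - Pi.single k 1) ((Real.sqrt (n k) : ℝ) : ℂ)

/-- Creation operator: `a_k† |n⟩ = √(n_k + 1) |n + e_k⟩`. -/
def create (k : Fin 2) : Module.End ℂ FinVec :=
  Finsupp.linearCombination ℂ fun n : Fin 2 → ℕ =>
    Finsupp.single (n + Pi.single k 1) ((Real.sqrt (n k + 1) : ℝ) : ℂ)

/-- `x_k = (a_k + a_k†) / √2`. -/
def position (k : Fin 2) : Module.End ℂ FinVec :=
  (1 / (Real.sqrt 2 : ℂ)) • (annihilate k + create k)

/-- `p_k = -i (a_k - a_k†) / √2`. -/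
def momentum (k : Fin 2) : Module.End ℂ FinVec :=
  (-Complex.I / (Real.sqrt 2 : ℂ)) • (annihilate k - create k)

/-- The vector of quadratures `(x₁, p₁, x₂, p₂)`. -/
def quadrature : Fin 4 → Module.End ℂ FinVec :=
  ![position 0, momentum 0, position 1, momentum 1]

/-! ### States and their moments -/

/-- Density operators on `ℓ²(ι)`: positive operators of trace one. -/
def IsDensity {ι : Type} [DecidableEq ι] (ρ : Ell2 ι →L[ℂ] Ell2 ι) : Prop :=
  ρ.IsPositive ∧ HasSum (fun i : ι => ⟪ket i, ρ (ket i)⟫_ℂ) 1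

/-- The mean total particle number `Tr[ρ (n₁ + n₂)]` is finite; equivalently, all second moments of
the ladder operators (and of the quadratures) are finite. -/
def FiniteMeanNumber (ρ : FockSpace →L[ℂ] FockSpace) : Prop :=
  Summable fun n : Fin 2 → ℕ => ((n 0 : ℝ) + (n 1 : ℝ)) * (⟪ket n, ρ (ket n)⟫_ℂ).re

/-- The expectation value `Tr[ρ A]`, as a trace over the number basis. For `A` a polynomial of
degree at most two in the ladder operators the series converges absolutely as soon as the mean
particle number is finite. -/
def expect (ρ : FockSpace →L[ℂ] FockSpace) (A : Module.End ℂ FinVec) : ℂ :=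
  ∑' n : Fin 2 → ℕ, ⟪ket n, ρ (toFock (A (Finsupp.single n 1)))⟫_ℂ

/-- The single-particle density matrix, `r_{kk'} = Tr[ρ a_{k'}† a_k]`. -/
def singleParticleMatrix (ρ : FockSpace →L[ℂ] FockSpace) : Matrix (Fin 2) (Fin 2) ℂ :=
  Matrix.of fun k k' => expect ρ (create k' * annihilate k)

/-- The averaged field, `α_k = Tr[ρ a_k]`. -/
def averagedField (ρ : FockSpace →L[ℂ] FockSpace) : Fin 2 → ℂ :=
  fun k => expect ρ (annihilate k)

/-- The reduced state of the field `(r, |α⟩)`. -/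
def rsf (ρ : FockSpace →L[ℂ] FockSpace) : Matrix (Fin 2) (Fin 2) ℂ × (Fin 2 → ℂ) :=
  (singleParticleMatrix ρ, averagedField ρ)

/-- The correlation matrix `r_α = r - |α⟩⟨α|`. -/
def correlationMatrix (ρ : FockSpace →L[ℂ] FockSpace) : Matrix (Fin 2) (Fin 2) ℂ :=
  singleParticleMatrix ρ - Matrix.vecMulVec (averagedField ρ) (star (averagedField ρ))

/-- First moments of the quadratures (these traces are real). -/
def firstMoments (ρ : FockSpace →L[ℂ] FockSpace) : Fin 4 → ℝ :=
  fun l => (expect ρ (quadrature l)).re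

/-- Symmetrised second moments of the quadratures, `½ Tr[ρ {ξ_l, ξ_m}]` (these traces are real). -/
def secondMoments (ρ : FockSpace →L[ℂ] FockSpace) : Matrix (Fin 4) (Fin 4) ℝ :=
  Matrix.of fun l m =>
    (1 / 2) * (expect ρ (quadrature l * quadrature m + quadrature m * quadrature l)).re

/-- The covariance matrix `V - |ξ⟩⟨ξ|`. -/
def covarianceMatrix (ρ : FockSpace →L[ℂ] FockSpace) : Matrix (Fin 4) (Fin 4) ℝ :=
  secondMoments ρ - Matrix.vecMulVec (firstMoments ρ) (firstMoments ρ)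

/-! ### Gaussian states -/

/-- The vector `exp(i η·ξ) |n⟩`, where `η·ξ = ∑ η_l ξ_l`, given by the exponential series (number
states are entire analytic vectors of `η·ξ`, so that the series converges in norm). -/
def weylKet (η : Fin 4 → ℝ) (n : Fin 2 → ℕ) : FockSpace :=
  ∑' j : ℕ, (Complex.I ^ j / (j.factorial : ℂ)) •
    toFock (((∑ l, (η l : ℂ) • quadrature l) ^ j) (Finsupp.single n 1))

/-- The characteristic function `Tr[ρ exp(i η·ξ)]`. -/
def charFunction (ρ : FockSpace →L[ℂ] FockSpace) (η : Fin 4 → ℝ) : ℂ :=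
  ∑' n : Fin 2 → ℕ, ⟪ket n, ρ (weylKet η n)⟫_ℂ

/-- Gaussian states: density operators (with finite second moments) whose characteristic function
is Gaussian, hence given by the first moments and the covariance matrix. -/
def IsGaussian (ρ : FockSpace →L[ℂ] FockSpace) : Prop :=
  IsDensity ρ ∧ FiniteMeanNumber ρ ∧
    ∀ η : Fin 4 → ℝ, charFunction ρ η =
      Complex.exp (Complex.I * ((η ⬝ᵥ firstMoments ρ : ℝ) : ℂ)
        - (1 / 2) * ((η ⬝ᵥ (covarianceMatrix ρ).mulVec η : ℝ) : ℂ))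

/-- The standard form of a two-mode covariance matrix. -/
def standardForm (a b cp cm : ℝ) : Matrix (Fin 4) (Fin 4) ℝ :=
  !![a, 0, cp, 0;
     0, a, 0, cm;
     cp, 0, b, 0;
     0, cm, 0, b]

/-! ### Separability -/

/-- Product states `τ = ρA ⊗ ρB` of the two modes, expressed by matrix elements. -/
def IsProductState (τ : FockSpace →L[ℂ] FockSpace) : Prop :=
  ∃ ρA ρB : Ell2 ℕ →L[ℂ] Ell2 ℕ, IsDensity ρA ∧ IsDensity ρB ∧
    ∀ m n : Fin 2 → ℕ, ⟪ket m, τ (ket n)⟫_ℂ =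
      ⟪ket (m 0), ρA (ket (n 0))⟫_ℂ * ⟪ket (m 1), ρB (ket (n 1))⟫_ℂ

/-- `‖T‖₁ ≤ c` for the trace norm, which is the supremum of `∑ |⟨u_i, T v_i⟩|` over the pairs of
finite orthonormal families. -/
def TraceNormLE (T : FockSpace →L[ℂ] FockSpace) (c : ℝ) : Prop :=
  ∀ (d : ℕ) (u v : Fin d → FockSpace), Orthonormal ℂ u → Orthonormal ℂ v →
    ∑ i, ‖⟪u i, T (v i)⟫_ℂ‖ ≤ c

/-- Separable states: trace-norm limits of finite convex combinations of product states. -/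
def IsSeparableState (σ : FockSpace →L[ℂ] FockSpace) : Prop :=
  IsDensity σ ∧ ∀ ε : ℝ, 0 < ε →
    ∃ τ ∈ convexHull ℝ {τ : FockSpace →L[ℂ] FockSpace | IsProductState τ}, TraceNormLE (σ - τ) ε

end BosonField

end

open BosonField

noncomputable section

namespace BosonField

open ComplexConjugate

/-! ### Matrix elements and ladder operators in the number basis -/

/-! The RSF determines the mean `α` and the normally ordered correlations `r_α = r - αα†`, but not
the anomalous moments `s = Tr[ρ a a]`. It can therefore be reproduced by a classical mixture of
coherent states.

The matrix `r_α` is positive semidefinite, since `⟨x, r_α x⟩ = Tr[ρ D†D]` with `D = ∑ conj (x k)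
(a_k - α_k)` (`LadderMoments.posSemidef`). Write `r_α = B Bᴴ` and let `σ = ∫ |β⟩⟨β| dν(β)`, with `ν`
the circular complex Gaussian law of mean `α` and covariance `B Bᴴ`. Coherent states are
eigenvectors of the `a_k`, so normally ordered moments of `σ` are classical moments of `ν`
(`ladderMoments_coherentMixture`). Hence `σ` has the RSF of `ρ`, and circularity gives `s = αα`.
Each `|β⟩` is a product vector, and discretising `ν` approximates `σ` in trace norm by finite
mixtures (`isSeparableState_coherentMixture`).

Gaussianity of `σ` requires its characteristic function. The Bargmann representation gives `⟨β|
exp(i η·ξ) |n⟩` in closed form (`hasSum_bargmann_weyl`). Summing over `n` and integrating over `ν`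
gives the vacuum factor times the characteristic function of `ν` (`charFunction_coherentMixture`,
`charFunction_complexGaussian`).

For a covariance matrix in standard form, `r_α` has diagonal `a - 1/2`, `b - 1/2` and off-diagonal
entry `(c₊ + c₋)/2`. The centred anomalous moments of `σ` vanish, so its covariance matrix depends
on `r_α` alone and both correlations become `(r_α)₁₂`. -/

theorem inner_ket {ι : Type} [DecidableEq ι] (i : ι) (f : Ell2 ι) : ⟪ket i, f⟫_ℂ = f i := by
  rw [ket, lp.inner_single_left]; simp

/-- Matrix elements `⟨m|ρ|n⟩` in the number basis. -/
def matrixElement {ι : Type} [DecidableEq ι] (ρ : Ell2 ι →L[ℂ] Ell2 ι) (m n : ι) : ℂ :=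
  ⟪ket m, ρ (ket n)⟫_ℂ

theorem toFock_single (n : Fin 2 → ℕ) (c : ℂ) : toFock (Finsupp.single n c) = c • ket n := by
  simp [toFock]

theorem annihilate_single (k : Fin 2) (n : Fin 2 → ℕ) (c : ℂ) :
    annihilate k (Finsupp.single n c) =
      Finsupp.single (n - Pi.single k 1) (c * ((Real.sqrt (n k) : ℝ) : ℂ)) := by
  simp [annihilate]

theorem create_single (k : Fin 2) (n : Fin 2 → ℕ) (c : ℂ) :
    create k (Finsupp.single n c) =
      Finsupp.single (n + Pi.single k 1) (c * ((Real.sqrt (n k + 1) : ℝ) : ℂ)) := by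
  simp [create]

/-- The canonical commutation relations. -/
theorem annihilate_mul_create (k k' : Fin 2) :
    annihilate k * create k' = create k' * annihilate k + (if k = k' then (1 : ℂ) else 0) • 1 := by
  refine Finsupp.lhom_ext fun n c => ?_
  simp only [Module.End.mul_apply, LinearMap.add_apply, create_single, annihilate_single,
    LinearMap.smul_apply, Module.End.one_apply, Finsupp.smul_single]
  by_cases h : k = k'
  · subst h
    simp only [Pi.add_apply, Pi.single_eq_same, add_tsub_cancel_right, if_true, smul_eq_mul,
      one_mul, Pi.sub_apply]
    -- For `n k = 0` the truncated `n - Pi.single k 1` is the wrong index, but its coefficient `√0`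
    -- vanishes.
    rcases Nat.eq_zero_or_pos (n k) with h0 | h0
    · simp [h0]
    · have : n - Pi.single k 1 + Pi.single k 1 = n := by
        ext i; by_cases hi : i = k
        · subst hi; simp; omega
        · simp [hi]
      rw [this, ← Finsupp.single_add]
      congr 1
      push_cast [Nat.cast_sub (show 1 ≤ n k from h0)]
      rw [mul_assoc, mul_assoc, ← Complex.ofReal_mul, ← Complex.ofReal_mul,
        Real.mul_self_sqrt (by positivity), sub_add_cancel, Real.mul_self_sqrt (by positivity)]
      push_cast; ring
  · have h' : ¬ k' = k := fun e => h e.symm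
    simp only [Pi.add_apply, Pi.sub_apply, Pi.single_eq_of_ne h, Pi.single_eq_of_ne h', h,
      if_false, Finsupp.single_zero, add_zero, Nat.sub_zero, smul_eq_mul, zero_mul]
    rw [mul_right_comm]
    congr 1
    ext i
    by_cases hi : i = k
    · subst hi; simp [h]
    · simp [hi]

theorem annihilate_mul_annihilate (k k' : Fin 2) :
    annihilate k * annihilate k' = annihilate k' * annihilate k := by
  refine Finsupp.lhom_ext fun n c => ?_
  simp only [Module.End.mul_apply, annihilate_single]
  rw [tsub_right_comm]
  by_cases h : k = k'
  · subst h; rfl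
  · have h' : ¬ k' = k := fun e => h e.symm
    simp [Pi.single_eq_of_ne h, Pi.single_eq_of_ne h', mul_right_comm]

/-! ### Traces over the number basis -/

/-- The series of `Tr[ρ A]` over the number basis converges to `x`. -/
def HasTrace (ρ : FockSpace →L[ℂ] FockSpace) (A : Module.End ℂ FinVec) (x : ℂ) : Prop :=
  HasSum (fun n : Fin 2 → ℕ => ⟪ket n, ρ (toFock (A (Finsupp.single n 1)))⟫_ℂ) x

section HasTrace
variable {ρ : FockSpace →L[ℂ] FockSpace} {A A' : Module.End ℂ FinVec} {x x' : ℂ}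

/-- A divergent `tsum` is `0`, so `expect` is not additive in general. Moment identities are proved
for `HasTrace`, which records convergence, and transferred here. -/
theorem HasTrace.expect_eq (h : HasTrace ρ A x) : expect ρ A = x := HasSum.tsum_eq h

theorem HasTrace.add (h : HasTrace ρ A x) (h' : HasTrace ρ A' x') :
    HasTrace ρ (A + A') (x + x') := by
  simpa [HasTrace, inner_add_right] using HasSum.add h h'

theorem HasTrace.smul (c : ℂ) (h : HasTrace ρ A x) : HasTrace ρ (c • A) (c * x) := by
  simpa [HasTrace, inner_smul_right] using HasSum.mul_left c h

theorem hasTrace_iff_of_single {s : (Fin 2 → ℕ) → (Fin 2 → ℕ)} {c : (Fin 2 → ℕ) → ℂ}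
    (hA : ∀ n, A (Finsupp.single n 1) = Finsupp.single (s n) (c n)) :
    HasTrace ρ A x ↔ HasSum (fun n => c n * matrixElement ρ n (s n)) x := by
  simp [HasTrace, hA, toFock_single, matrixElement]

/-- Annihilation operators kill the states outside the range of a shift `t`, so the trace can be
reindexed along `t`. This removes truncated subtractions from the series. -/
theorem hasTrace_of_shift {s t : (Fin 2 → ℕ) → (Fin 2 → ℕ)} {c : (Fin 2 → ℕ) → ℂ}
    (hA : ∀ n, A (Finsupp.single n 1) = Finsupp.single (s n) (c n))
    (ht : Function.Injective t) (hc : ∀ n, c n ≠ 0 → n ∈ Set.range t)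
    (h : HasSum (fun l => c (t l) * matrixElement ρ (t l) (s (t l))) x) : HasTrace ρ A x := by
  rw [hasTrace_iff_of_single hA]
  refine (ht.hasSum_iff fun n hn => ?_).1 h
  rw [show c n = 0 from by_contra fun h0 => hn (hc n h0), zero_mul]

end HasTrace

/-! ### Moments of the ladder operators -/

/-- `ρ` has trace one, and `α_k = Tr[ρ a_k]`, `r_{kk'} = Tr[ρ a_{k'}† a_k]`,
`s_{kk'} = Tr[ρ a_k a_{k'}]`, expressed as convergent series of matrix elements. -/
structure LadderMoments (ρ : FockSpace →L[ℂ] FockSpace) (α : Fin 2 → ℂ)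
    (r s : Matrix (Fin 2) (Fin 2) ℂ) : Prop where
  conj_symm : ∀ m n, conj (matrixElement ρ m n) = matrixElement ρ n m
  trace_one : HasSum (fun n => matrixElement ρ n n) 1
  field : ∀ k, HasSum (fun l : Fin 2 → ℕ => ((Real.sqrt (l k + 1) : ℝ) : ℂ) *
    matrixElement ρ (l + Pi.single k 1) l) (α k)
  particle : ∀ k k', HasSum (fun l : Fin 2 → ℕ => ((Real.sqrt (l k + 1) : ℝ) : ℂ) *
    ((Real.sqrt (l k' + 1) : ℝ) : ℂ) *
    matrixElement ρ (l + Pi.single k 1) (l + Pi.single k' 1)) (r k k')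
  anomalous : ∀ k k', HasSum (fun l : Fin 2 → ℕ => ((Real.sqrt (l k + 1) : ℝ) : ℂ) *
    ((Real.sqrt ((l + Pi.single k 1 : Fin 2 → ℕ) k' + 1) : ℝ) : ℂ) *
    matrixElement ρ (l + Pi.single k 1 + Pi.single k' 1) l) (s k k')

/-- The self-adjoint operator `u a_k + ū a_k†`. -/
def ladderForm (k : Fin 2) (u : ℂ) : Module.End ℂ FinVec :=
  u • annihilate k + conj u • create k

theorem exists_eq_add_single {n : Fin 2 → ℕ} {k : Fin 2} (h : n k ≠ 0) :
    n - Pi.single k 1 + Pi.single k 1 = n := by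
  ext i; by_cases hi : i = k
  · subst hi; simp; omega
  · simp [hi]

namespace LadderMoments
variable {ρ : FockSpace →L[ℂ] FockSpace} {α : Fin 2 → ℂ} {r s : Matrix (Fin 2) (Fin 2) ℂ}
  (h : LadderMoments ρ α r s)
include h

theorem hasTrace_one : HasTrace ρ 1 1 := by
  rw [hasTrace_iff_of_single (s := id) (c := fun _ => 1) (by simp)]
  simpa using h.trace_one

theorem hasTrace_annihilate (k : Fin 2) : HasTrace ρ (annihilate k) (α k) := by
  refine hasTrace_of_shift (t := fun l => l + Pi.single k 1) (fun n => annihilate_single k n 1)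
    (add_left_injective _) (fun n hn => ⟨n - Pi.single k 1, exists_eq_add_single ?_⟩) ?_
  · rintro h0; simp [h0] at hn
  · simpa using h.field k

theorem hasTrace_create (k : Fin 2) : HasTrace ρ (create k) (conj (α k)) := by
  rw [hasTrace_iff_of_single (fun n => create_single k n 1)]
  have := (Complex.hasSum_conj').2 (h.field k)
  simpa [Complex.conj_ofReal, h.conj_symm] using this

theorem hasTrace_create_annihilate (k k' : Fin 2) :
    HasTrace ρ (create k' * annihilate k) (r k k') := by
  refine hasTrace_of_shift (t := fun l => l + Pi.single k 1)
    (fun n => by rw [Module.End.mul_apply, annihilate_single, create_single])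
    (add_left_injective _) (fun n hn => ⟨n - Pi.single k 1, exists_eq_add_single ?_⟩) ?_
  · rintro h0; simp [h0] at hn
  · simpa using h.particle k k'

theorem hasTrace_annihilate_annihilate (k k' : Fin 2) :
    HasTrace ρ (annihilate k * annihilate k') (s k k') := by
  refine hasTrace_of_shift (t := fun l => l + Pi.single k 1 + Pi.single k' 1)
    (fun n => by rw [Module.End.mul_apply, annihilate_single, annihilate_single])
    ((add_left_injective _).comp (add_left_injective _))
    (fun n hn => ⟨n - Pi.single k' 1 - Pi.single k 1, ?_⟩) ?_
  · dsimp only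
    rw [exists_eq_add_single, exists_eq_add_single]
    · rintro h0; simp [h0] at hn
    · intro h0; rw [h0] at hn; simp at hn
  · simpa [mul_comm] using h.anomalous k k'

theorem hasTrace_create_create (k k' : Fin 2) :
    HasTrace ρ (create k' * create k) (conj (s k k')) := by
  rw [hasTrace_iff_of_single (s := fun n => n + Pi.single k 1 + Pi.single k' 1)
    (fun n => by rw [Module.End.mul_apply, create_single, create_single])]
  have := (Complex.hasSum_conj').2 (h.anomalous k k')
  simpa [Complex.conj_ofReal, h.conj_symm] using this

theorem conj_particle (k k' : Fin 2) : conj (r k k') = r k' k := by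
  have := (Complex.hasSum_conj').2 (h.particle k k')
  simp only [map_mul, Complex.conj_ofReal, h.conj_symm] at this
  exact this.unique (by simpa [mul_comm, mul_left_comm] using h.particle k' k)

theorem anomalous_symm (k k' : Fin 2) : s k k' = s k' k := by
  have h1 := h.hasTrace_annihilate_annihilate k k'
  rw [annihilate_mul_annihilate] at h1
  exact h1.unique (h.hasTrace_annihilate_annihilate k' k)

theorem rsf_eq : rsf ρ = (r, α) := by
  refine Prod.ext ?_ ?_
  · ext k k'; exact (h.hasTrace_create_annihilate k k').expect_eq
  · ext k; exact (h.hasTrace_annihilate k).expect_eq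

theorem hasTrace_ladderForm (k : Fin 2) (u : ℂ) :
    HasTrace ρ (ladderForm k u) (u * α k + conj u * conj (α k)) :=
  ((h.hasTrace_annihilate k).smul u).add ((h.hasTrace_create k).smul _)

/-- Of the four products only `a a†` is out of normal order; its commutator produces the Kronecker
delta. -/
theorem hasTrace_ladderForm_mul (k k' : Fin 2) (u u' : ℂ) :
    HasTrace ρ (ladderForm k u * ladderForm k' u')
      (u * u' * s k k' + conj u * conj u' * conj (s k k')
        + u * conj u' * (r k k' + if k = k' then 1 else 0) + conj u * u' * conj (r k k')) := by
  have h1 := (h.hasTrace_annihilate_annihilate k k').smul (u * u')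
  have h2 := (h.hasTrace_create_create k' k).smul (conj u * conj u')
  have h3 := ((h.hasTrace_create_annihilate k k').add
    (h.hasTrace_one.smul (if k = k' then 1 else 0))).smul (u * conj u')
  have h4 := (h.hasTrace_create_annihilate k' k).smul (conj u * u')
  rw [← annihilate_mul_create] at h3
  rw [h.anomalous_symm k' k] at h2
  rw [← h.conj_particle k k'] at h4
  convert ((h1.add h2).add h3).add h4 using 1
  · simp only [ladderForm, add_mul, mul_add, smul_mul_assoc, mul_smul_comm]
    simp only [smul_add, smul_smul]
    rw [mul_comm u' u, mul_comm (conj u') u, mul_comm u' (conj u), mul_comm (conj u') (conj u)]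
    abel
  · rw [mul_one]

theorem firstMoment_ladderForm (k : Fin 2) (u : ℂ) :
    (expect ρ (ladderForm k u)).re = 2 * (u * α k).re := by
  rw [(h.hasTrace_ladderForm k u).expect_eq, ← map_mul, Complex.add_re, Complex.conj_re]
  ring

/-- The two orders contribute commutators weighted by `u ū'` and by its conjugate; symmetrising
leaves the vacuum noise `1 / 2`. -/
theorem secondMoment_ladderForm (k k' : Fin 2) (u u' : ℂ) :
    (1 / 2) * (expect ρ (ladderForm k u * ladderForm k' u' + ladderForm k' u' * ladderForm k u)).re
      = 2 * (u * u' * s k k' + u * conj u' * (r k k' + if k = k' then 1 / 2 else 0)).re := by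
  rw [((h.hasTrace_ladderForm_mul k k' u u').add (h.hasTrace_ladderForm_mul k' k u' u)).expect_eq,
    h.anomalous_symm k' k, ← h.conj_particle k k']
  by_cases hk : k = k'
  · simp [hk]; ring
  · rw [if_neg hk, if_neg hk, if_neg (Ne.symm hk)]
    simp; ring

end LadderMoments

/-- The mode to which a quadrature belongs. -/
def quadratureMode : Fin 4 → Fin 2 := ![0, 0, 1, 1]

/-- The coefficient `u` for which a quadrature is `u a + ū a†`. -/
def quadratureCoeff : Fin 4 → ℂ :=
  ![1 / (Real.sqrt 2 : ℂ), -Complex.I / (Real.sqrt 2 : ℂ),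
    1 / (Real.sqrt 2 : ℂ), -Complex.I / (Real.sqrt 2 : ℂ)]

theorem quadrature_eq_ladderForm (l : Fin 4) :
    quadrature l = ladderForm (quadratureMode l) (quadratureCoeff l) := by
  have hp (k : Fin 2) : position k = ladderForm k (1 / (Real.sqrt 2 : ℂ)) := by
    simp [position, ladderForm]
  have hm (k : Fin 2) : momentum k = ladderForm k (-Complex.I / (Real.sqrt 2 : ℂ)) := by
    simp [momentum, ladderForm, neg_div]; module
  fin_cases l <;> simp [quadrature, quadratureMode, quadratureCoeff, hp, hm]

/-! ### Mean, covariance and correlation matrices from ladder moments -/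

namespace LadderMoments
variable {ρ : FockSpace →L[ℂ] FockSpace} {α : Fin 2 → ℂ} {r s : Matrix (Fin 2) (Fin 2) ℂ}
  (h : LadderMoments ρ α r s)
include h

theorem firstMoments_apply (l : Fin 4) :
    firstMoments ρ l = 2 * (quadratureCoeff l * α (quadratureMode l)).re := by
  rw [firstMoments, quadrature_eq_ladderForm, h.firstMoment_ladderForm]

/-- Since `4 Re x Re y = 2 Re (x y + x ȳ)`, subtracting the product of first moments centres `s` and
`r` separately. -/
theorem covarianceMatrix_apply (l m : Fin 4) :
    covarianceMatrix ρ l m =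
      2 * (quadratureCoeff l * quadratureCoeff m *
          (s (quadratureMode l) (quadratureMode m) - α (quadratureMode l) * α (quadratureMode m))
        + quadratureCoeff l * conj (quadratureCoeff m) *
          (r (quadratureMode l) (quadratureMode m) - α (quadratureMode l) *
            conj (α (quadratureMode m)) +
            if quadratureMode l = quadratureMode m then 1 / 2 else 0)).re := by
  rw [covarianceMatrix, Matrix.sub_apply, Matrix.vecMulVec_apply, secondMoments, Matrix.of_apply,
    h.firstMoments_apply, h.firstMoments_apply, quadrature_eq_ladderForm, quadrature_eq_ladderForm,
    h.secondMoment_ladderForm]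
  split_ifs <;> simp <;> ring

theorem correlationMatrix_apply (k k' : Fin 2) :
    correlationMatrix ρ k k' = r k k' - α k * conj (α k') := by
  have h1 := congrArg Prod.fst h.rsf_eq
  have h2 := congrArg Prod.snd h.rsf_eq
  simp only [rsf] at h1 h2
  rw [correlationMatrix, h1, h2, Matrix.sub_apply, Matrix.vecMulVec_apply]
  rfl

end LadderMoments

section

open ComplexOrder

/-! ### Ladder moments of states with finite mean particle number -/

/-- Cauchy–Schwarz for the form `⟪x, T y⟫ = ⟪S x, S y⟫`, where `T = S* S`, followed by the
inequality of means. -/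
theorem norm_inner_apply_le {E : Type*} [NormedAddCommGroup E] [InnerProductSpace ℂ E]
    [CompleteSpace E] {T : E →L[ℂ] E} (hT : T.IsPositive) (x y : E) :
    ‖⟪x, T y⟫_ℂ‖ ≤ ((⟪x, T x⟫_ℂ).re + (⟪y, T y⟫_ℂ).re) / 2 := by
  obtain ⟨S, hS⟩ := CStarAlgebra.nonneg_iff_eq_star_mul_self.1
    ((ContinuousLinearMap.nonneg_iff_isPositive T).2 hT)
  have key (u v : E) : ⟪u, T v⟫_ℂ = ⟪S u, S v⟫_ℂ := by
    rw [hS, mul_apply_eq_comp, ContinuousLinearMap.star_eq_adjoint,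
      ContinuousLinearMap.adjoint_inner_right]
  have hsq (u : E) : (⟪u, T u⟫_ℂ).re = ‖S u‖ ^ 2 := by
    rw [key]; exact inner_self_eq_norm_sq (𝕜 := ℂ) (S u)
  rw [hsq, hsq, key]
  nlinarith [norm_inner_le_norm (𝕜 := ℂ) (S x) (S y), sq_nonneg (‖S x‖ - ‖S y‖)]

theorem matrixElement_conj {ι : Type} [DecidableEq ι] {ρ : Ell2 ι →L[ℂ] Ell2 ι}
    (hρ : ρ.IsPositive) (m n : ι) : conj (matrixElement ρ m n) = matrixElement ρ n m := by
  rw [matrixElement, inner_conj_symm, matrixElement]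
  exact hρ.isSymmetric _ _

/-- Off-diagonal elements are dominated by the two diagonal ones, which are summable against the
particle number plus a constant. The slack `2` covers `a_k a_k'`, whose weight at `l` can reach
`√((N+1)(N+2))` with `N` the particle number of `l`. -/
theorem summable_mul_matrixElement {ρ : FockSpace →L[ℂ] FockSpace} (hρ : IsDensity ρ)
    (hf : FiniteMeanNumber ρ) {c : (Fin 2 → ℕ) → ℂ} {s t : (Fin 2 → ℕ) → (Fin 2 → ℕ)}
    (hs : Function.Injective s) (ht : Function.Injective t)
    (hcs : ∀ l, ‖c l‖ ≤ (s l 0 : ℝ) + s l 1 + 2) (hct : ∀ l, ‖c l‖ ≤ (t l 0 : ℝ) + t l 1 + 2) :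
    Summable fun l => c l * matrixElement ρ (s l) (t l) := by
  have hQ : Summable fun n : Fin 2 → ℕ => ((n 0 : ℝ) + n 1 + 2) * (matrixElement ρ n n).re := by
    have h1 : Summable fun n : Fin 2 → ℕ => (matrixElement ρ n n).re :=
      (Complex.hasSum_re hρ.2).summable
    refine (Summable.add hf (h1.mul_left 2)).congr fun n => ?_
    rw [add_mul _ (2 : ℝ)]; rfl
  refine Summable.of_norm_bounded (((hQ.comp_injective hs).add (hQ.comp_injective ht))) fun l => ?_
  have h0 (n : Fin 2 → ℕ) : 0 ≤ (matrixElement ρ n n).re := by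
    simpa [matrixElement] using hρ.1.re_inner_nonneg_right (ket n)
  have hb : ‖matrixElement ρ (s l) (t l)‖ ≤
      (matrixElement ρ (s l) (s l)).re + (matrixElement ρ (t l) (t l)).re := by
    have := norm_inner_apply_le hρ.1 (ket (s l)) (ket (t l))
    have h1 := h0 (s l)
    have h2 := h0 (t l)
    simp only [matrixElement] at *
    linarith
  rw [norm_mul]
  calc _ ≤ ‖c l‖ * ((matrixElement ρ (s l) (s l)).re + (matrixElement ρ (t l) (t l)).re) := by
        gcongr
    _ ≤ _ := by
        rw [mul_add]
        exact add_le_add (mul_le_mul_of_nonneg_right (hcs l) (h0 _))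
          (mul_le_mul_of_nonneg_right (hct l) (h0 _))

theorem apply_le_add (l : Fin 2 → ℕ) (k : Fin 2) : (l k : ℝ) ≤ (l 0 : ℝ) + l 1 := by
  fin_cases k <;> simp

theorem sqrt_mul_sqrt_le {a b c : ℝ} (hc : 0 ≤ c) (ha : a ≤ c) (hb : b ≤ c) :
    Real.sqrt a * Real.sqrt b ≤ c :=
  (mul_le_mul (Real.sqrt_le_sqrt ha) (Real.sqrt_le_sqrt hb) (Real.sqrt_nonneg _)
    (Real.sqrt_nonneg _)).trans (Real.mul_self_sqrt hc).le

theorem total_add_single (l : Fin 2 → ℕ) (k : Fin 2) :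
    (((l + Pi.single k 1 : Fin 2 → ℕ) 0 : ℕ) : ℝ) + ((l + Pi.single k 1 : Fin 2 → ℕ) 1 : ℕ)
      = (l 0 : ℝ) + l 1 + 1 := by
  fin_cases k <;> simp <;> ring

theorem exists_ladderMoments {ρ : FockSpace →L[ℂ] FockSpace} (hρ : IsDensity ρ)
    (hf : FiniteMeanNumber ρ) : ∃ α r s, LadderMoments ρ α r s := by
  have hN (l : Fin 2 → ℕ) : (0 : ℝ) ≤ (l 0 : ℝ) + l 1 := by positivity
  refine ⟨_, Matrix.of fun k k' => _, Matrix.of fun k k' => _, matrixElement_conj hρ.1, hρ.2,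
    fun k => (summable_mul_matrixElement hρ hf (add_left_injective _) Function.injective_id
      (fun l => ?_) (fun l => ?_)).hasSum,
    fun k k' => (summable_mul_matrixElement hρ hf (add_left_injective _) (add_left_injective _)
      (fun l => ?_) (fun l => ?_)).hasSum,
    fun k k' => (summable_mul_matrixElement hρ hf
      ((add_left_injective (Pi.single k' 1)).comp (add_left_injective (Pi.single k 1)))
      Function.injective_id (fun l => ?_) (fun l => ?_)).hasSum⟩
  all_goals
    have h1 := hN l
    have h2 := apply_le_add l k
    simp only [norm_mul, Complex.norm_real, Real.norm_eq_abs, abs_of_nonneg (Real.sqrt_nonneg _),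
      total_add_single, id, Function.comp]
  · exact Real.sqrt_le_iff.2 ⟨by positivity, by nlinarith⟩
  · exact Real.sqrt_le_iff.2 ⟨by positivity, by nlinarith⟩
  all_goals
    have h3 := apply_le_add l k'
    have h4 := apply_le_add (l + Pi.single k 1) k'
    rw [total_add_single] at h4
    exact sqrt_mul_sqrt_le (by linarith) (by linarith) (by linarith)

/-- The correlation matrix is positive semidefinite. -/
theorem LadderMoments.posSemidef {ρ : FockSpace →L[ℂ] FockSpace} {α : Fin 2 → ℂ}
    {r s : Matrix (Fin 2) (Fin 2) ℂ} (h : LadderMoments ρ α r s) (hρ : ρ.IsPositive) :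
    (Matrix.of fun k k' => r k k' - α k * conj (α k') : Matrix _ _ ℂ).PosSemidef := by
  have hherm : (Matrix.of fun k k' => r k k' - α k * conj (α k') :
      Matrix (Fin 2) (Fin 2) ℂ).IsHermitian := by
    ext k k'
    simp [Matrix.conjTranspose_apply, h.conj_particle, mul_comm]
  refine Matrix.PosSemidef.of_dotProduct_mulVec_nonneg hherm fun x => ?_
  -- With `D = ∑ conj (x k) (a_k - α_k)`, the vector `v l` is `D† |l⟩`. Summing `⟨v l, ρ (v l)⟩`
  -- over `l` gives `Tr[ρ D†D]`, which is already in normal order, so no commutator appears.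
  set t : ℂ := x 0 * conj (α 0) + x 1 * conj (α 1) with ht
  let v (l : Fin 2 → ℕ) : FockSpace :=
    (x 0 * (Real.sqrt (l 0 + 1) : ℝ)) • ket (l + Pi.single 0 1) +
    (x 1 * (Real.sqrt (l 1 + 1) : ℝ)) • ket (l + Pi.single 1 1) - t • ket l
  have hα (k) := (Complex.hasSum_conj').2 (h.field k)
  have hsum := ((((h.particle 0 0).mul_left (conj (x 0) * x 0)).add
    ((h.particle 0 1).mul_left (conj (x 0) * x 1))).add
    (((h.particle 1 0).mul_left (conj (x 1) * x 0)).add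
    ((h.particle 1 1).mul_left (conj (x 1) * x 1)))).sub
    ((((h.field 0).mul_left (conj (x 0) * t)).add ((h.field 1).mul_left (conj (x 1) * t))).add
      (((hα 0).mul_left (x 0 * conj t)).add ((hα 1).mul_left (x 1 * conj t)))) |>.add
    (h.trace_one.mul_left (conj t * t))
  have hv : ∀ l, 0 ≤ ⟪v l, ρ (v l)⟫_ℂ := fun l => hρ.inner_nonneg_right (v l)
  have hnonneg := HasSum.nonneg (fun l => ?_) hsum
  · convert hnonneg using 1
    simp [Matrix.mulVec, dotProduct, Fin.sum_univ_two, ht]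
    ring
  · convert hv l using 1
    simp only [map_mul, Complex.conj_ofReal, h.conj_symm]
    simp only [v, map_add, map_sub, map_smul, inner_add_left, inner_add_right, inner_sub_left,
      inner_sub_right, inner_smul_left, inner_smul_right, map_mul, Complex.conj_ofReal,
      matrixElement]
    ring

end

/-! ### Coherent states -/

theorem hasSum_mul_fin_two {R : Type*} [NormedRing R] [CompleteSpace R] {f g : ℕ → R} {a b : R}
    (hf : HasSum f a) (hg : HasSum g b) (hf' : Summable fun n => ‖f n‖)
    (hg' : Summable fun n => ‖g n‖) :
    HasSum (fun n : Fin 2 → ℕ => f (n 0) * g (n 1)) (a * b) :=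
  (finTwoArrowEquiv ℕ).hasSum_iff.2 (hf.mul hg (summable_mul_of_summable_norm hf' hg'))

/-- The coefficients `exp(-|b|²/2) bⁿ / √n!` of a coherent state. -/
def coherentCoeff (b : ℂ) (n : ℕ) : ℂ :=
  ((Real.exp (-‖b‖ ^ 2 / 2) : ℝ) : ℂ) * (b ^ n / ((Real.sqrt n.factorial : ℝ) : ℂ))

theorem ofReal_sqrt_mul_self {x : ℝ} (hx : 0 ≤ x) :
    ((Real.sqrt x : ℝ) : ℂ) * ((Real.sqrt x : ℝ) : ℂ) = (x : ℂ) := by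
  rw [← Complex.ofReal_mul, Real.mul_self_sqrt hx]

theorem conj_coherentCoeff_mul (b c : ℂ) (n : ℕ) : conj (coherentCoeff b n) * coherentCoeff c n =
    ((Real.exp (-‖b‖ ^ 2 / 2) * Real.exp (-‖c‖ ^ 2 / 2) : ℝ) : ℂ) *
      ((conj b * c) ^ n / (n.factorial : ℂ)) := by
  have h := ofReal_sqrt_mul_self (Nat.cast_nonneg (α := ℝ) n.factorial)
  rw [coherentCoeff, coherentCoeff, map_mul, map_div₀, map_pow, Complex.conj_ofReal,
    Complex.conj_ofReal, mul_pow, show ((n.factorial : ℂ)) = ((n.factorial : ℝ) : ℂ) by simp, ← h]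
  push_cast
  simp only [div_eq_mul_inv, mul_inv]
  ring

theorem summable_norm_pow_div_factorial (z : ℂ) :
    Summable fun n : ℕ => ‖z ^ n / (n.factorial : ℂ)‖ := by
  simpa using Real.summable_pow_div_factorial ‖z‖

theorem hasSum_pow_div_factorial (z : ℂ) :
    HasSum (fun n : ℕ => z ^ n / (n.factorial : ℂ)) (Complex.exp z) := by
  rw [Complex.exp_eq_exp_ℂ]; exact NormedSpace.expSeries_div_hasSum_exp z

theorem summable_norm_conj_coherentCoeff_mul (b c : ℂ) :
    Summable fun n => ‖conj (coherentCoeff b n) * coherentCoeff c n‖ := by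
  simp_rw [conj_coherentCoeff_mul, norm_mul _ (_ ^ _ / _)]
  exact (summable_norm_pow_div_factorial _).mul_left _

theorem hasSum_conj_coherentCoeff_mul (b c : ℂ) :
    HasSum (fun n => conj (coherentCoeff b n) * coherentCoeff c n)
      (((Real.exp (-‖b‖ ^ 2 / 2) * Real.exp (-‖c‖ ^ 2 / 2) : ℝ) : ℂ) *
        Complex.exp (conj b * c)) := by
  simp_rw [conj_coherentCoeff_mul]
  exact (hasSum_pow_div_factorial _).mul_left _

theorem sqrt_mul_coherentCoeff_succ (b : ℂ) (n : ℕ) :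
    ((Real.sqrt (n + 1) : ℝ) : ℂ) * coherentCoeff b (n + 1) = b * coherentCoeff b n := by
  have h1 : ((Real.sqrt (n + 1) : ℝ) : ℂ) ≠ 0 := by
    simpa using (Real.sqrt_pos.2 (by positivity : (0 : ℝ) < n + 1)).ne'
  have h2 : ((Real.sqrt n.factorial : ℝ) : ℂ) ≠ 0 := by
    simpa using (Real.sqrt_pos.2 (by positivity : (0 : ℝ) < n.factorial)).ne'
  rw [coherentCoeff, coherentCoeff, Nat.factorial_succ, Nat.cast_mul,
    Real.sqrt_mul (by positivity), pow_succ]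
  push_cast at *
  field_simp
  ring

theorem memℓp_two_of_summable {ι : Type} {f : ι → ℂ} (h : Summable fun i => ‖conj (f i) * f i‖) :
    Memℓp f 2 := by
  refine memℓp_gen (h.congr fun i => ?_)
  simp [sq]

theorem hasSum_conj_mul {ι : Type} (x y : Ell2 ι) :
    HasSum (fun i => conj (x i) * y i) ⟪x, y⟫_ℂ := by
  have h := lp.hasSum_inner (𝕜 := ℂ) x y
  simp only [RCLike.inner_apply] at h
  simpa only [mul_comm] using h

theorem norm_eq_one_of_inner {E : Type*} [NormedAddCommGroup E] [InnerProductSpace ℂ E] {x : E}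
    (h : ⟪x, x⟫_ℂ = 1) : ‖x‖ = 1 := by
  rw [@norm_eq_sqrt_re_inner ℂ, h]; simp

/-- The coherent state `|b⟩` of one mode. -/
def coherentMode (b : ℂ) : Ell2 ℕ :=
  ⟨coherentCoeff b, memℓp_two_of_summable (summable_norm_conj_coherentCoeff_mul b b)⟩

theorem hasSum_conj_coherent_mul (β γ : Fin 2 → ℂ) :
    HasSum (fun n : Fin 2 → ℕ =>
      conj (coherentCoeff (β 0) (n 0) * coherentCoeff (β 1) (n 1)) *
        (coherentCoeff (γ 0) (n 0) * coherentCoeff (γ 1) (n 1)))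
      ((((Real.exp (-‖β 0‖ ^ 2 / 2) * Real.exp (-‖γ 0‖ ^ 2 / 2) : ℝ) : ℂ) *
        Complex.exp (conj (β 0) * γ 0)) *
       (((Real.exp (-‖β 1‖ ^ 2 / 2) * Real.exp (-‖γ 1‖ ^ 2 / 2) : ℝ) : ℂ) *
        Complex.exp (conj (β 1) * γ 1))) := by
  have := hasSum_mul_fin_two (hasSum_conj_coherentCoeff_mul (β 0) (γ 0))
    (hasSum_conj_coherentCoeff_mul (β 1) (γ 1)) (summable_norm_conj_coherentCoeff_mul _ _)
    (summable_norm_conj_coherentCoeff_mul _ _)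
  simpa only [map_mul, mul_mul_mul_comm] using this

/-- The coherent state `|β⟩ = |β₀⟩ ⊗ |β₁⟩` of two modes. -/
def coherent (β : Fin 2 → ℂ) : FockSpace :=
  ⟨fun n => coherentCoeff (β 0) (n 0) * coherentCoeff (β 1) (n 1),
    memℓp_two_of_summable (hasSum_conj_coherent_mul β β).summable.norm⟩

theorem coherent_apply (β : Fin 2 → ℂ) (n : Fin 2 → ℕ) :
    coherent β n = coherentCoeff (β 0) (n 0) * coherentCoeff (β 1) (n 1) := rfl

theorem inner_coherent (β γ : Fin 2 → ℂ) : ⟪coherent β, coherent γ⟫_ℂ =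
    (((Real.exp (-‖β 0‖ ^ 2 / 2) * Real.exp (-‖γ 0‖ ^ 2 / 2) : ℝ) : ℂ) *
        Complex.exp (conj (β 0) * γ 0)) *
       (((Real.exp (-‖β 1‖ ^ 2 / 2) * Real.exp (-‖γ 1‖ ^ 2 / 2) : ℝ) : ℂ) *
        Complex.exp (conj (β 1) * γ 1)) := by
  exact (hasSum_conj_mul (coherent β) (coherent γ)).unique (hasSum_conj_coherent_mul β γ)

theorem exp_mul_exp_mul_exp_conj_self (b : ℂ) :
    ((Real.exp (-‖b‖ ^ 2 / 2) * Real.exp (-‖b‖ ^ 2 / 2) : ℝ) : ℂ) *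
      Complex.exp (conj b * b) = 1 := by
  rw [Complex.conj_mul', ← Real.exp_add, Complex.ofReal_exp, ← Complex.exp_add]
  rw [← Complex.exp_zero]
  congr 1
  push_cast
  ring

theorem norm_coherentMode (b : ℂ) : ‖coherentMode b‖ = 1 := by
  refine norm_eq_one_of_inner ?_
  rw [← exp_mul_exp_mul_exp_conj_self b]
  exact (hasSum_conj_mul (coherentMode b) (coherentMode b)).unique
    (hasSum_conj_coherentCoeff_mul b b)

theorem norm_coherent (β : Fin 2 → ℂ) : ‖coherent β‖ = 1 := by
  refine norm_eq_one_of_inner ?_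
  rw [inner_coherent, exp_mul_exp_mul_exp_conj_self, exp_mul_exp_mul_exp_conj_self, one_mul]

/-- For unit vectors `‖x - y‖² = 2 - 2 Re ⟪x, y⟫`, and the overlap of coherent states is an explicit
continuous function. -/
theorem continuous_coherent : Continuous coherent := by
  refine continuous_iff_continuousAt.2 fun β => ?_
  have h (γ : Fin 2 → ℂ) : ‖coherent γ - coherent β‖ =
      Real.sqrt (2 - 2 * (⟪coherent γ, coherent β⟫_ℂ).re) := by
    rw [← Real.sqrt_sq (norm_nonneg (coherent γ - coherent β)),
      @norm_sub_sq ℂ, norm_coherent, norm_coherent]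
    congr 1
    simp only [RCLike.re_to_complex]; ring
  refine tendsto_iff_norm_sub_tendsto_zero.2 ?_
  simp_rw [h, inner_coherent]
  have hc : Continuous fun γ : Fin 2 → ℂ => Real.sqrt (2 - 2 *
    ((((Real.exp (-‖γ 0‖ ^ 2 / 2) * Real.exp (-‖β 0‖ ^ 2 / 2) : ℝ) : ℂ) *
        Complex.exp (conj (γ 0) * β 0)) *
       (((Real.exp (-‖γ 1‖ ^ 2 / 2) * Real.exp (-‖β 1‖ ^ 2 / 2) : ℝ) : ℂ) *
        Complex.exp (conj (γ 1) * β 1))).re) := by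
    have := Complex.continuous_conj
    fun_prop
  convert hc.tendsto β using 2
  rw [exp_mul_exp_mul_exp_conj_self, exp_mul_exp_mul_exp_conj_self]
  simp

theorem isDensity_rankOne {ι : Type} [DecidableEq ι] {x : Ell2 ι} (hx : ‖x‖ = 1) :
    IsDensity (InnerProductSpace.rankOne ℂ x x) := by
  refine ⟨InnerProductSpace.isPositive_rankOne_self x, ?_⟩
  have h := hasSum_conj_mul x x
  rw [inner_self_eq_norm_sq_to_K, hx] at h
  simpa [InnerProductSpace.inner_right_rankOne_apply, inner_ket,
    ← inner_conj_symm x (ket _), mul_comm] using h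

theorem matrixElement_rankOne {ι : Type} [DecidableEq ι] (x : Ell2 ι) (m n : ι) :
    matrixElement (InnerProductSpace.rankOne ℂ x x) m n = x m * conj (x n) := by
  rw [matrixElement, InnerProductSpace.inner_right_rankOne_apply, inner_ket,
    ← inner_conj_symm x (ket n), inner_ket]

theorem isProductState_coherent (β : Fin 2 → ℂ) :
    IsProductState (InnerProductSpace.rankOne ℂ (coherent β) (coherent β)) := by
  refine ⟨_, _, isDensity_rankOne (norm_coherentMode (β 0)),
    isDensity_rankOne (norm_coherentMode (β 1)), fun m n => ?_⟩
  have h1 := matrixElement_rankOne (coherent β) m n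
  have h2 := matrixElement_rankOne (coherentMode (β 0)) (m 0) (n 0)
  have h3 := matrixElement_rankOne (coherentMode (β 1)) (m 1) (n 1)
  simp only [matrixElement] at h1 h2 h3
  rw [h1, h2, h3, coherent_apply, coherent_apply, map_mul]
  exact mul_mul_mul_comm _ _ _ _

/-- Coherent states are eigenvectors of the annihilation operators. -/
theorem sqrt_mul_coherent_add_single (β : Fin 2 → ℂ) (k : Fin 2) (l : Fin 2 → ℕ) :
    ((Real.sqrt (l k + 1) : ℝ) : ℂ) * coherent β (l + Pi.single k 1) = β k * coherent β l := by
  rw [coherent_apply, coherent_apply]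
  fin_cases k
  · simpa [mul_assoc] using
      congrArg (· * coherentCoeff (β 1) (l 1)) (sqrt_mul_coherentCoeff_succ (β 0) (l 0))
  · simpa [mul_left_comm] using
      congrArg (coherentCoeff (β 0) (l 0) * ·) (sqrt_mul_coherentCoeff_succ (β 1) (l 1))

theorem hasSum_norm_sq_coherent (β : Fin 2 → ℂ) :
    HasSum (fun n => ‖coherent β n‖ ^ 2) 1 := by
  have h := lp.hasSum_norm (p := 2) (by norm_num) (coherent β)
  simpa [norm_coherent] using h

/-! ### The Bargmann representation -/

/-- The value at `w` of the Bargmann representative of a finite linear combination of number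
states, on which `a_k†` acts as multiplication by `w_k` and `a_k` as `∂/∂w_k`. -/
def bargmann (w : Fin 2 → ℂ) : FinVec →ₗ[ℂ] ℂ :=
  Finsupp.linearCombination ℂ fun n : Fin 2 → ℕ =>
    w 0 ^ n 0 / ((Real.sqrt (n 0).factorial : ℝ) : ℂ) *
      (w 1 ^ n 1 / ((Real.sqrt (n 1).factorial : ℝ) : ℂ))

theorem bargmann_single (w : Fin 2 → ℂ) (n : Fin 2 → ℕ) (c : ℂ) :
    bargmann w (Finsupp.single n c) =
      c * (w 0 ^ n 0 / ((Real.sqrt (n 0).factorial : ℝ) : ℂ) *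
      (w 1 ^ n 1 / ((Real.sqrt (n 1).factorial : ℝ) : ℂ))) := by
  simp [bargmann]

theorem sqrt_factorial_ne_zero (n : ℕ) : ((Real.sqrt n.factorial : ℝ) : ℂ) ≠ 0 := by
  simpa using (Real.sqrt_pos.2 (by positivity : (0 : ℝ) < n.factorial)).ne'

theorem sqrt_mul_pow_succ_div (w : ℂ) (n : ℕ) :
    ((Real.sqrt (n + 1) : ℝ) : ℂ) * (w ^ (n + 1) / ((Real.sqrt (n + 1).factorial : ℝ) : ℂ)) =
      w * (w ^ n / ((Real.sqrt n.factorial : ℝ) : ℂ)) := by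
  have h1 : ((Real.sqrt (n + 1) : ℝ) : ℂ) ≠ 0 := by
    simpa using (Real.sqrt_pos.2 (by positivity : (0 : ℝ) < n + 1)).ne'
  have h2 := sqrt_factorial_ne_zero n
  rw [Nat.factorial_succ, Nat.cast_mul, Real.sqrt_mul (by positivity), pow_succ]
  push_cast at *
  field_simp

theorem sqrt_mul_pow_pred_div (w : ℂ) (n : ℕ) :
    ((Real.sqrt n : ℝ) : ℂ) * (w ^ (n - 1) / ((Real.sqrt (n - 1).factorial : ℝ) : ℂ)) =
      n * w ^ (n - 1) / ((Real.sqrt n.factorial : ℝ) : ℂ) := by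
  rcases n with _ | n
  · simp
  · have h1 : ((Real.sqrt (n + 1) : ℝ) : ℂ) ≠ 0 := by
      simpa using (Real.sqrt_pos.2 (by positivity : (0 : ℝ) < n + 1)).ne'
    have h2 := sqrt_factorial_ne_zero n
    have h3 := ofReal_sqrt_mul_self (by positivity : (0 : ℝ) ≤ n + 1)
    rw [Nat.add_sub_cancel, Nat.factorial_succ, Nat.cast_mul, Real.sqrt_mul (by positivity)]
    push_cast at *
    field_simp
    rw [sq, h3, mul_comm]

theorem bargmann_create (w : Fin 2 → ℂ) (k : Fin 2) (v : FinVec) :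
    bargmann w (create k v) = w k * bargmann w v := by
  induction v using Finsupp.induction_linear with
  | zero => simp
  | add f g hf hg => rw [map_add, map_add, map_add, hf, hg, mul_add]
  | single n c =>
    rw [create_single, bargmann_single, bargmann_single]
    fin_cases k
    · have := sqrt_mul_pow_succ_div (w 0) (n 0)
      simp only [Fin.zero_eta, Pi.add_apply, Pi.single_eq_same, ne_eq, one_ne_zero,
        not_false_eq_true, Pi.single_eq_of_ne, add_zero]
      linear_combination (c * (w 1 ^ n 1 / ((Real.sqrt (n 1).factorial : ℝ) : ℂ))) * this
    · have := sqrt_mul_pow_succ_div (w 1) (n 1)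
      simp only [Fin.mk_one, Pi.add_apply, Pi.single_eq_same, ne_eq, zero_ne_one,
        not_false_eq_true, Pi.single_eq_of_ne, add_zero]
      linear_combination (c * (w 0 ^ n 0 / ((Real.sqrt (n 0).factorial : ℝ) : ℂ))) * this

theorem bargmann_annihilate_single (w : Fin 2 → ℂ) (n : Fin 2 → ℕ) (c : ℂ) :
    bargmann w (annihilate 0 (Finsupp.single n c)) =
      c * (n 0 * w 0 ^ (n 0 - 1) / ((Real.sqrt (n 0).factorial : ℝ) : ℂ) *
        (w 1 ^ n 1 / ((Real.sqrt (n 1).factorial : ℝ) : ℂ))) ∧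
    bargmann w (annihilate 1 (Finsupp.single n c)) =
      c * (w 0 ^ n 0 / ((Real.sqrt (n 0).factorial : ℝ) : ℂ) *
        (n 1 * w 1 ^ (n 1 - 1) / ((Real.sqrt (n 1).factorial : ℝ) : ℂ))) := by
  rw [annihilate_single, annihilate_single, bargmann_single, bargmann_single]
  constructor
  · have := sqrt_mul_pow_pred_div (w 0) (n 0)
    simp only [Pi.sub_apply, Pi.single_eq_same, ne_eq, one_ne_zero,
        not_false_eq_true, Pi.single_eq_of_ne, Nat.sub_zero]
    linear_combination (c * (w 1 ^ n 1 / ((Real.sqrt (n 1).factorial : ℝ) : ℂ))) * this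
  · have := sqrt_mul_pow_pred_div (w 1) (n 1)
    simp only [Pi.sub_apply, Pi.single_eq_same, ne_eq, zero_ne_one,
        not_false_eq_true, Pi.single_eq_of_ne, Nat.sub_zero]
    linear_combination (c * (w 0 ^ n 0 / ((Real.sqrt (n 0).factorial : ℝ) : ℂ))) * this

/-- The generator `∑_k (u_k a_k + ū_k a_k†)` of a Weyl operator. -/
def weylGenerator (u : Fin 2 → ℂ) : Module.End ℂ FinVec :=
  ladderForm 0 (u 0) + ladderForm 1 (u 1)

/-- The Bargmann representative of `exp(i t ∑_k (u_k a_k + ū_k a_k†)) v`. -/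
def bargmannWeyl (u w : Fin 2 → ℂ) (v : FinVec) (t : ℂ) : ℂ :=
  Complex.exp (-(t ^ 2 / 2) * (u 0 * conj (u 0) + u 1 * conj (u 1)) +
    Complex.I * t * (conj (u 0) * w 0 + conj (u 1) * w 1)) *
  bargmann (fun k => w k + Complex.I * t * u k) v

/-- The closed form solves the Schrödinger equation of the generator. The exponent has derivative `i
ū·(w + i t u)`, which is the creation part at the shifted point; differentiating the shifted
polynomial gives `i u·∂`, the annihilation part. -/
theorem hasDerivAt_bargmannWeyl (u w : Fin 2 → ℂ) (v : FinVec) (t : ℂ) :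
    HasDerivAt (bargmannWeyl u w v)
      (bargmannWeyl u w ((Complex.I • weylGenerator u) v) t) t := by
  induction v using Finsupp.induction_linear with
  | zero =>
    have : bargmannWeyl u w 0 = fun _ => 0 := by ext; simp [bargmannWeyl]
    rw [map_zero, this]
    exact hasDerivAt_const t 0
  | add f g hf hg =>
    have h (f g) : bargmannWeyl u w (f + g) = bargmannWeyl u w f + bargmannWeyl u w g := by
      ext; simp [bargmannWeyl, mul_add]
    rw [map_add, h, h]
    exact hf.add hg
  | single n c =>
    have hq : HasDerivAt (fun t : ℂ =>
        -(t ^ 2 / 2) * (u 0 * conj (u 0) + u 1 * conj (u 1)) +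
          Complex.I * t * (conj (u 0) * w 0 + conj (u 1) * w 1))
        (-t * (u 0 * conj (u 0) + u 1 * conj (u 1)) +
          Complex.I * (conj (u 0) * w 0 + conj (u 1) * w 1)) t := by
      have h1 := ((((hasDerivAt_id t).pow 2).div_const 2).neg.mul_const
        (u 0 * conj (u 0) + u 1 * conj (u 1))).add
        (((hasDerivAt_id t).const_mul Complex.I).mul_const (conj (u 0) * w 0 + conj (u 1) * w 1))
      convert! h1 using 1
      simp
    have hp (k : Fin 2) : HasDerivAt (fun t : ℂ =>
        (w k + Complex.I * t * u k) ^ n k / ((Real.sqrt (n k).factorial : ℝ) : ℂ))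
        (n k * (w k + Complex.I * t * u k) ^ (n k - 1) * (Complex.I * u k) /
          ((Real.sqrt (n k).factorial : ℝ) : ℂ)) t := by
      have h1 := (((((hasDerivAt_id t).const_mul Complex.I).mul_const (u k)).const_add
        (w k)).pow (n k)).div_const ((Real.sqrt (n k).factorial : ℝ) : ℂ)
      convert! h1 using 1
      simp
    have h := hq.cexp.mul (((hp 0).mul (hp 1)).const_mul c)
    refine (h.congr_of_eventuallyEq (.of_forall fun t => ?_)).congr_deriv ?_
    · exact congrArg _ (bargmann_single (fun k => w k + Complex.I * t * u k) n c)
    have ha := bargmann_annihilate_single (fun k => w k + Complex.I * t * u k) n c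
    simp only [bargmannWeyl, weylGenerator, ladderForm, LinearMap.smul_apply, LinearMap.add_apply,
      map_smul, map_add, bargmann_create, ha.1, ha.2, smul_eq_mul, bargmann_single, Pi.mul_apply]
    ring_nf
    simp only [Complex.I_sq]
    ring

theorem iteratedDeriv_bargmannWeyl (u w : Fin 2 → ℂ) (v : FinVec) (j : ℕ) :
    iteratedDeriv j (bargmannWeyl u w v) =
      bargmannWeyl u w (((Complex.I • weylGenerator u) ^ j) v) := by
  induction j generalizing v with
  | zero => simp
  | succ j ih =>
    rw [iteratedDeriv_succ', funext fun t => (hasDerivAt_bargmannWeyl u w v t).deriv, ih, pow_succ,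
      Module.End.mul_apply]

/-- The exponential series is the Taylor series at `0`, evaluated at `1`, of the entire function
`bargmannWeyl u w v`. -/
theorem hasSum_bargmann_weyl (u w : Fin 2 → ℂ) (v : FinVec) :
    HasSum (fun j : ℕ => Complex.I ^ j / (j.factorial : ℂ) *
      bargmann w ((weylGenerator u ^ j) v)) (bargmannWeyl u w v 1) := by
  have hd : Differentiable ℂ (bargmannWeyl u w v) := fun t =>
    (hasDerivAt_bargmannWeyl u w v t).differentiableAt
  have h := Complex.hasSum_taylorSeries_of_entire hd 0 1
  convert! h using 2 with j
  rw [iteratedDeriv_bargmannWeyl, smul_pow]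
  simp [bargmannWeyl]
  ring

/-! ### Convergence of the exponential series on number states -/

/-- The `ℓ¹` norm of a finite linear combination of number states. -/
def l1Norm (v : FinVec) : ℝ := ∑ n ∈ v.support, ‖v n‖

theorem l1Norm_eq_sum {v : FinVec} {s : Finset (Fin 2 → ℕ)} (h : v.support ⊆ s) :
    l1Norm v = ∑ n ∈ s, ‖v n‖ :=
  Finset.sum_subset h fun n _ hn => by simpa using hn

theorem l1Norm_nonneg (v : FinVec) : 0 ≤ l1Norm v := Finset.sum_nonneg fun _ _ => norm_nonneg _

theorem l1Norm_single (n : Fin 2 → ℕ) (c : ℂ) : l1Norm (Finsupp.single n c) = ‖c‖ := by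
  rw [l1Norm_eq_sum Finsupp.support_single_subset]; simp

theorem l1Norm_add_le (v w : FinVec) : l1Norm (v + w) ≤ l1Norm v + l1Norm w := by
  classical
  rw [l1Norm_eq_sum Finsupp.support_add, l1Norm_eq_sum (Finset.subset_union_left (s₂ := w.support)),
    l1Norm_eq_sum (Finset.subset_union_right (s₁ := v.support)), ← Finset.sum_add_distrib]
  exact Finset.sum_le_sum fun n _ => norm_add_le _ _

theorem l1Norm_smul (c : ℂ) (v : FinVec) : l1Norm (c • v) = ‖c‖ * l1Norm v := by
  rw [l1Norm_eq_sum (Finsupp.support_smul (b := c) (g := v)), l1Norm, Finset.mul_sum]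
  simp

theorem l1Norm_map_le {T : Module.End ℂ FinVec} {v : FinVec} {C : ℝ}
    (h : ∀ n ∈ v.support, l1Norm (T (Finsupp.single n 1)) ≤ C) :
    l1Norm (T v) ≤ C * l1Norm v := by
  have hv : T v = ∑ n ∈ v.support, v n • T (Finsupp.single n 1) := by
    conv_lhs => rw [← Finsupp.sum_single v]
    rw [Finsupp.sum, map_sum]
    refine Finset.sum_congr rfl fun n _ => ?_
    rw [← map_smul, Finsupp.smul_single, smul_eq_mul, mul_one]
  rw [hv, show C * l1Norm v = ∑ n ∈ v.support, C * ‖v n‖ from Finset.mul_sum ..]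
  refine (Finset.le_sum_of_subadditive l1Norm (by simp [l1Norm]) l1Norm_add_le _ _).trans
    (Finset.sum_le_sum fun n hn => ?_)
  rw [l1Norm_smul, mul_comm]
  exact mul_le_mul_of_nonneg_right (h n hn) (norm_nonneg _)

theorem norm_ket {ι : Type} [DecidableEq ι] (i : ι) : ‖ket i‖ = 1 := by
  rw [ket, lp.norm_single (by norm_num)]; simp

theorem norm_toFock_le (v : FinVec) : ‖toFock v‖ ≤ l1Norm v := by
  rw [toFock, Finsupp.linearCombination_apply, Finsupp.sum]
  refine (norm_sum_le _ _).trans (Finset.sum_le_sum fun n _ => ?_)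
  rw [norm_smul, norm_ket, mul_one]

/-- The span of the number states with at most `N` particles. -/
def numberLE (N : ℕ) : Submodule ℂ FinVec := Finsupp.supported ℂ ℂ {n | n 0 + n 1 ≤ N}

theorem map_mem_of_single {T : Module.End ℂ FinVec} {N : ℕ} {p : Submodule ℂ FinVec}
    (h : ∀ n : Fin 2 → ℕ, n 0 + n 1 ≤ N → T (Finsupp.single n 1) ∈ p) {v : FinVec}
    (hv : v ∈ numberLE N) : T v ∈ p := by
  have hv' : numberLE N ≤ p.comap T := by
    rw [numberLE, Finsupp.supported_eq_span_single, Submodule.span_le]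
    rintro _ ⟨n, hn, rfl⟩
    exact h n hn
  exact hv' hv

theorem ladderForm_mem_numberLE {k : Fin 2} {u : ℂ} {N : ℕ} {v : FinVec} (hv : v ∈ numberLE N) :
    ladderForm k u v ∈ numberLE (N + 1) := by
  refine map_mem_of_single (fun n hn => ?_) hv
  refine Submodule.add_mem _ (Submodule.smul_mem _ _ ?_) (Submodule.smul_mem _ _ ?_)
  · rw [annihilate_single]
    refine Finsupp.single_mem_supported _ _ ?_
    have := fun i => (Nat.sub_le (n i) ((Pi.single k 1 : Fin 2 → ℕ) i))
    have h0 := this 0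
    have h1 := this 1
    simp only [Set.mem_ofPred_eq, Pi.sub_apply]
    omega
  · rw [create_single]
    refine Finsupp.single_mem_supported _ _ ?_
    fin_cases k <;> simp <;> omega

theorem l1Norm_ladderForm_le {k : Fin 2} {u : ℂ} {N : ℕ} {v : FinVec} (hv : v ∈ numberLE N) :
    l1Norm (ladderForm k u v) ≤ 2 * ‖u‖ * Real.sqrt (N + 1) * l1Norm v := by
  refine l1Norm_map_le fun n hn => ?_
  have hn' : n 0 + n 1 ≤ N := (Finsupp.mem_supported ℂ v).1 hv hn
  have hk : (n k : ℝ) ≤ N := (apply_le_add n k).trans (by exact_mod_cast hn')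
  refine (l1Norm_add_le _ _).trans ?_
  rw [LinearMap.smul_apply, LinearMap.smul_apply, l1Norm_smul, l1Norm_smul, annihilate_single,
    create_single, l1Norm_single, l1Norm_single]
  have h1 : Real.sqrt (n k) ≤ Real.sqrt (N + 1) := Real.sqrt_le_sqrt (by linarith)
  have h2 : Real.sqrt (n k + 1) ≤ Real.sqrt (N + 1) := Real.sqrt_le_sqrt (by linarith)
  simp only [one_mul, Complex.norm_real, Real.norm_eq_abs, abs_of_nonneg (Real.sqrt_nonneg _),
    RCLike.norm_conj]
  nlinarith [norm_nonneg u]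

theorem weylGenerator_mem_numberLE {u : Fin 2 → ℂ} {N : ℕ} {v : FinVec} (hv : v ∈ numberLE N) :
    weylGenerator u v ∈ numberLE (N + 1) :=
  Submodule.add_mem _ (ladderForm_mem_numberLE hv) (ladderForm_mem_numberLE hv)

theorem l1Norm_weylGenerator_le {u : Fin 2 → ℂ} {N : ℕ} {v : FinVec} (hv : v ∈ numberLE N) :
    l1Norm (weylGenerator u v) ≤ 2 * (‖u 0‖ + ‖u 1‖) * Real.sqrt (N + 1) * l1Norm v := by
  refine (l1Norm_add_le _ _).trans ((add_le_add (l1Norm_ladderForm_le hv)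
    (l1Norm_ladderForm_le hv)).trans_eq ?_)
  ring

/-- Each application of the generator adds at most one particle and costs a factor `C √(N + j + 1)`,
which the factor `j + 1` of the factorial eventually beats. -/
theorem summable_l1Norm_weyl (u : Fin 2 → ℂ) (n : Fin 2 → ℕ) :
    Summable fun j : ℕ => l1Norm ((weylGenerator u ^ j) (Finsupp.single n 1)) / j.factorial := by
  set N := n 0 + n 1 with hN
  set C := 2 * (‖u 0‖ + ‖u 1‖) with hC
  have hC0 : 0 ≤ C := by positivity
  have hmem (j : ℕ) : (weylGenerator u ^ j) (Finsupp.single n 1) ∈ numberLE (N + j) := by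
    induction j with
    | zero => exact Finsupp.single_mem_supported _ _ (by simp [hN])
    | succ j ih =>
      rw [pow_succ', Module.End.mul_apply]
      exact weylGenerator_mem_numberLE ih
  refine summable_of_ratio_norm_eventually_le (r := 1 / 2) (by norm_num) ?_
  -- Beyond this threshold `2 C √(N + j + 1) ≤ j + 1`, because `N + j + 1 ≤ (N + 1)(j + 1)`; the
  -- ratio is then at most `1 / 2`.
  have hev : ∀ᶠ j : ℕ in Filter.atTop, (2 * C) ^ 2 * (N + 1) ≤ (j : ℝ) :=
    tendsto_natCast_atTop_atTop.eventually_ge_atTop _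
  filter_upwards [hev] with j hj
  have hstep := l1Norm_weylGenerator_le (u := u) (hmem j)
  rw [← Module.End.mul_apply, ← pow_succ'] at hstep
  have hsqrt : 2 * C * Real.sqrt ((N + j : ℕ) + 1) ≤ j + 1 := by
    rw [← abs_of_nonneg (by positivity : (0 : ℝ) ≤ 2 * C * Real.sqrt ((N + j : ℕ) + 1))]
    refine abs_le_of_sq_le_sq ?_ (by positivity)
    rw [mul_pow, Real.sq_sqrt (by positivity)]
    push_cast
    have : (N + j + 1 : ℝ) ≤ (N + 1) * (j + 1) := by nlinarith [(N.cast_nonneg : (0 : ℝ) ≤ N),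
      (j.cast_nonneg : (0 : ℝ) ≤ j)]
    calc (2 * C) ^ 2 * (N + j + 1 : ℝ) ≤ (2 * C) ^ 2 * ((N + 1) * (j + 1)) := by gcongr
      _ = ((2 * C) ^ 2 * (N + 1)) * (j + 1) := by ring
      _ ≤ (j + 1) * (j + 1) := by gcongr; linarith
      _ = _ := by ring
  have hl := l1Norm_nonneg ((weylGenerator u ^ j) (Finsupp.single n 1))
  have hl' := l1Norm_nonneg ((weylGenerator u ^ (j + 1)) (Finsupp.single n 1))
  rw [Real.norm_of_nonneg (by positivity), Real.norm_of_nonneg (by positivity),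
    Nat.factorial_succ, div_le_iff₀ (by positivity)]
  have hf : (0 : ℝ) < j.factorial := by positivity
  push_cast
  field_simp
  nlinarith

/-- The coefficients of the annihilation operators in `∑ η_l ξ_l`. -/
def weylCoeff (η : Fin 4 → ℝ) : Fin 2 → ℂ :=
  ![η 0 * quadratureCoeff 0 + η 1 * quadratureCoeff 1,
    η 2 * quadratureCoeff 2 + η 3 * quadratureCoeff 3]

theorem sum_smul_quadrature (η : Fin 4 → ℝ) :
    ∑ l, (η l : ℂ) • quadrature l = weylGenerator (weylCoeff η) := by
  simp only [quadrature_eq_ladderForm, Fin.sum_univ_four, weylGenerator, ladderForm, weylCoeff,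
    Matrix.cons_val_zero, Matrix.cons_val_one, map_add, map_mul, Complex.conj_ofReal,
    show quadratureMode 0 = 0 from rfl, show quadratureMode 1 = 0 from rfl,
    show quadratureMode 2 = 1 from rfl, show quadratureMode 3 = 1 from rfl]
  module

theorem hasSum_weylKet (η : Fin 4 → ℝ) (n : Fin 2 → ℕ) :
    HasSum (fun j : ℕ => (Complex.I ^ j / (j.factorial : ℂ)) •
      toFock ((weylGenerator (weylCoeff η) ^ j) (Finsupp.single n 1))) (weylKet η n) := by
  rw [weylKet, sum_smul_quadrature]
  refine Summable.hasSum (Summable.of_norm_bounded (summable_l1Norm_weyl (weylCoeff η) n)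
    fun j => ?_)
  rw [norm_smul, norm_div, norm_pow, Complex.norm_I, one_pow, Complex.norm_natCast, one_div,
    inv_mul_eq_div]
  gcongr
  exact norm_toFock_le _

theorem inner_coherent_toFock (β : Fin 2 → ℂ) (v : FinVec) : ⟪coherent β, toFock v⟫_ℂ =
    ((Real.exp (-(‖β 0‖ ^ 2 + ‖β 1‖ ^ 2) / 2) : ℝ) : ℂ) * bargmann (fun k => conj (β k)) v := by
  induction v using Finsupp.induction_linear with
  | zero => simp
  | add f g hf hg => rw [map_add, map_add, inner_add_right, hf, hg, mul_add]
  | single n c =>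
    rw [toFock_single, inner_smul_right, ← inner_conj_symm, inner_ket, coherent_apply,
      bargmann_single, coherentCoeff, coherentCoeff, neg_add, add_div, Real.exp_add]
    simp only [map_mul, map_div₀, map_pow, Complex.conj_ofReal, Complex.ofReal_mul]
    ring

theorem inner_coherent_weylKet (β : Fin 2 → ℂ) (η : Fin 4 → ℝ) (n : Fin 2 → ℕ) :
    ⟪coherent β, weylKet η n⟫_ℂ =
    ((Real.exp (-(‖β 0‖ ^ 2 + ‖β 1‖ ^ 2) / 2) : ℝ) : ℂ) *
      bargmannWeyl (weylCoeff η) (fun k => conj (β k)) (Finsupp.single n 1) 1 := by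
  have h1 := (innerSL ℂ (coherent β)).hasSum (hasSum_weylKet η n)
  simp only [map_smul, innerSL_apply_apply, inner_coherent_toFock, smul_eq_mul] at h1
  refine h1.unique ?_
  simpa only [mul_left_comm] using (hasSum_bargmann_weyl (weylCoeff η) (fun k => conj (β k))
    (Finsupp.single n 1)).mul_left ((Real.exp (-(‖β 0‖ ^ 2 + ‖β 1‖ ^ 2) / 2) : ℝ) : ℂ)

open MeasureTheory

/-! ### Mixtures of coherent states -/

/-- The mixture `∫ |β⟩⟨β| dν(β)` of coherent states. -/
def coherentMixture (ν : Measure (Fin 2 → ℂ)) : FockSpace →L[ℂ] FockSpace :=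
  ∫ β, InnerProductSpace.rankOne ℂ (coherent β) (coherent β) ∂ν

theorem continuous_rankOne_coherent :
    Continuous fun β => InnerProductSpace.rankOne ℂ (coherent β) (coherent β) :=
  ((ContinuousLinearMap.smulRightL ℂ FockSpace FockSpace).continuous.comp
    ((innerSL ℂ).continuous.comp continuous_coherent)).clm_apply continuous_coherent

section
variable {ν : Measure (Fin 2 → ℂ)}

theorem integrable_rankOne_coherent [IsProbabilityMeasure ν] :
    Integrable (fun β => InnerProductSpace.rankOne ℂ (coherent β) (coherent β)) ν :=
  Integrable.of_bound continuous_rankOne_coherent.aestronglyMeasurable 1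
    (.of_forall fun β => by simp [norm_coherent])

theorem inner_coherentMixture [IsProbabilityMeasure ν] (x y : FockSpace) :
    ⟪x, coherentMixture ν y⟫_ℂ = ∫ β, ⟪x, coherent β⟫_ℂ * ⟪coherent β, y⟫_ℂ ∂ν := by
  rw [coherentMixture, ContinuousLinearMap.integral_apply integrable_rankOne_coherent,
    ← integral_inner (integrable_rankOne_coherent.apply_continuousLinearMap y)]
  simp_rw [InnerProductSpace.inner_right_rankOne_apply]

theorem isPositive_coherentMixture [IsProbabilityMeasure ν] : (coherentMixture ν).IsPositive := by
  have h (x : FockSpace) : ⟪coherentMixture ν x, x⟫_ℂ =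
      ((∫ β, ‖⟪coherent β, x⟫_ℂ‖ ^ 2 ∂ν : ℝ) : ℂ) := by
    rw [← inner_conj_symm, inner_coherentMixture, ← Complex.conj_ofReal]
    congr 1
    rw [← integral_complex_ofReal]
    refine integral_congr_ae (.of_forall fun β => ?_)
    dsimp only
    rw [← inner_conj_symm, Complex.conj_mul']
    push_cast; rfl
  rw [ContinuousLinearMap.isPositive_iff_complex]
  intro x
  rw [h]
  exact ⟨by simp, by simpa using integral_nonneg fun β => by positivity⟩

theorem matrixElement_coherentMixture [IsProbabilityMeasure ν] (m n : Fin 2 → ℕ) :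
    matrixElement (coherentMixture ν) m n = ∫ β, coherent β m * conj (coherent β n) ∂ν := by
  rw [matrixElement, inner_coherentMixture]
  simp_rw [inner_ket, ← inner_conj_symm (coherent _) (ket n), inner_ket]

/-- Exchanges trace and mixture: `∑ |⟨l|β⟩|² = 1`, so the dominating functions sum to `‖f β‖`. -/
theorem hasSum_integral_mul_coherent {f : (Fin 2 → ℂ) → ℂ} (hf : Integrable f ν) :
    HasSum (fun l => ∫ β, f β * (coherent β l * conj (coherent β l)) ∂ν) (∫ β, f β ∂ν) := by
  have hc (l : Fin 2 → ℕ) : Continuous fun β => coherent β l := by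
    simp_rw [← inner_ket]; exact continuous_const.inner continuous_coherent
  have hn (β l) : ‖f β * (coherent β l * conj (coherent β l))‖ = ‖f β‖ * ‖coherent β l‖ ^ 2 := by
    simp [sq]
  refine hasSum_integral_of_dominated_convergence (fun l β => ‖f β‖ * ‖coherent β l‖ ^ 2)
    (fun l => hf.aestronglyMeasurable.mul
      ((hc l).mul (Complex.continuous_conj.comp (hc l))).aestronglyMeasurable)
    (fun l => .of_forall fun β => (hn β l).le)
    (.of_forall fun β => (hasSum_norm_sq_coherent β).summable.mul_left _) ?_
    (.of_forall fun β => ?_)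
  · simp_rw [tsum_mul_left, (hasSum_norm_sq_coherent _).tsum_eq, mul_one]
    exact hf.norm
  · have h := ((Complex.hasSum_ofReal).2 (hasSum_norm_sq_coherent β)).mul_left (f β)
    simpa [Complex.mul_conj'] using h

/-- The eigenvalue equation turns each raised index into a factor `β k` or its conjugate, leaving
`|⟨l|β⟩|²` to be summed over `l`. -/
theorem ladderMoments_coherentMixture [IsProbabilityMeasure ν]
    (h1 : ∀ k, Integrable (fun β : Fin 2 → ℂ => β k) ν)
    (h2 : ∀ k k', Integrable (fun β : Fin 2 → ℂ => β k * β k') ν)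
    (h3 : ∀ k k', Integrable (fun β : Fin 2 → ℂ => β k * conj (β k')) ν) :
    LadderMoments (coherentMixture ν) (fun k => ∫ β, β k ∂ν)
      (Matrix.of fun k k' => ∫ β, β k * conj (β k') ∂ν)
      (Matrix.of fun k k' => ∫ β, β k * β k' ∂ν) where
  conj_symm := matrixElement_conj isPositive_coherentMixture
  trace_one := by
    simpa [matrixElement_coherentMixture] using hasSum_integral_mul_coherent
      (ν := ν) (f := fun _ => 1) (integrable_const _)
  field k := by
    convert! hasSum_integral_mul_coherent (h1 k) using 2 with l
    rw [matrixElement_coherentMixture, ← integral_const_mul]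
    refine integral_congr_ae (.of_forall fun β => ?_)
    dsimp only
    rw [← mul_assoc, sqrt_mul_coherent_add_single, mul_assoc]
  particle k k' := by
    convert! hasSum_integral_mul_coherent (h3 k k') using 2 with l
    rw [matrixElement_coherentMixture, ← integral_const_mul]
    refine integral_congr_ae (.of_forall fun β => ?_)
    dsimp only
    have e1 := sqrt_mul_coherent_add_single β k l
    have e2 := congrArg conj (sqrt_mul_coherent_add_single β k' l)
    rw [map_mul, map_mul, Complex.conj_ofReal] at e2
    rw [mul_mul_mul_comm, e1, e2, mul_mul_mul_comm]
  anomalous k k' := by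
    convert! hasSum_integral_mul_coherent (h2 k k') using 2 with l
    rw [matrixElement_coherentMixture, ← integral_const_mul]
    refine integral_congr_ae (.of_forall fun β => ?_)
    dsimp only
    have e1 := sqrt_mul_coherent_add_single β k l
    have e2 := sqrt_mul_coherent_add_single β k' (l + Pi.single k 1)
    rw [mul_assoc, ← mul_assoc _ _ (conj _), e2]
    linear_combination (β k' * conj (coherent β l)) * e1

end

/-- The diagonal series `particle k k` is the series of `n_k`, shifted past its vanishing terms at
`n_k = 0`. -/
theorem LadderMoments.finiteMeanNumber {ρ : FockSpace →L[ℂ] FockSpace} {α : Fin 2 → ℂ}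
    {r s : Matrix (Fin 2) (Fin 2) ℂ} (h : LadderMoments ρ α r s) : FiniteMeanNumber ρ := by
  have hk (k : Fin 2) : Summable fun n : Fin 2 → ℕ => (n k : ℝ) * (matrixElement ρ n n).re := by
    refine ((add_left_injective (Pi.single k 1)).summable_iff fun n hn => ?_).1 ?_
    · have : n k = 0 := by
        by_contra h0
        exact hn ⟨n - Pi.single k 1, exists_eq_add_single h0⟩
      simp [this]
    · refine (Complex.hasSum_re (h.particle k k)).summable.congr fun l => ?_
      rw [ofReal_sqrt_mul_self (by positivity), Complex.re_ofReal_mul]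
      simp
  refine ((hk 0).add (hk 1)).congr fun n => ?_
  rw [← add_mul]; rfl

/-! ### Characteristic functions of mixtures of coherent states -/

/-- The square roots of factorials pair up, so the dependence on `n` is that of a product of two
exponential series. -/
theorem coherent_mul_inner_weylKet (β : Fin 2 → ℂ) (η : Fin 4 → ℝ) (n : Fin 2 → ℕ) :
    coherent β n * ⟪coherent β, weylKet η n⟫_ℂ =
      Complex.exp (-(β 0 * conj (β 0) + β 1 * conj (β 1))
        - (weylCoeff η 0 * conj (weylCoeff η 0) + weylCoeff η 1 * conj (weylCoeff η 1)) / 2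
        + Complex.I * (conj (weylCoeff η 0) * conj (β 0) + conj (weylCoeff η 1) * conj (β 1))) *
      ((β 0 * (conj (β 0) + Complex.I * weylCoeff η 0)) ^ n 0 / ((n 0).factorial : ℂ) *
        ((β 1 * (conj (β 1) + Complex.I * weylCoeff η 1)) ^ n 1 / ((n 1).factorial : ℂ))) := by
  have hf (m : ℕ) : (m.factorial : ℂ) =
      ((Real.sqrt m.factorial : ℝ) : ℂ) * ((Real.sqrt m.factorial : ℝ) : ℂ) := by
    rw [ofReal_sqrt_mul_self (by positivity)]; simp
  have he : Complex.exp (-(β 0 * conj (β 0) + β 1 * conj (β 1))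
        - (weylCoeff η 0 * conj (weylCoeff η 0) + weylCoeff η 1 * conj (weylCoeff η 1)) / 2
        + Complex.I * (conj (weylCoeff η 0) * conj (β 0) + conj (weylCoeff η 1) * conj (β 1))) =
      ((Real.exp (-‖β 0‖ ^ 2 / 2) : ℝ) : ℂ) * ((Real.exp (-‖β 1‖ ^ 2 / 2) : ℝ) : ℂ) *
      ((Real.exp (-(‖β 0‖ ^ 2 + ‖β 1‖ ^ 2) / 2) : ℝ) : ℂ) *
      Complex.exp (-(1 ^ 2 / 2) *
        (weylCoeff η 0 * conj (weylCoeff η 0) + weylCoeff η 1 * conj (weylCoeff η 1))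
        + Complex.I * 1 *
          (conj (weylCoeff η 0) * conj (β 0) + conj (weylCoeff η 1) * conj (β 1))) := by
    rw [Complex.ofReal_exp, Complex.ofReal_exp, Complex.ofReal_exp, ← Complex.exp_add,
      ← Complex.exp_add, ← Complex.exp_add]
    congr 1
    rw [Complex.mul_conj' (β 0), Complex.mul_conj' (β 1)]
    push_cast
    ring
  rw [inner_coherent_weylKet, he, hf, hf, coherent_apply, coherentCoeff, coherentCoeff,
    bargmannWeyl, bargmann_single]
  simp only [div_eq_mul_inv, mul_inv, mul_pow, mul_one]
  ring

theorem charFunction_coherentMixture {ν : Measure (Fin 2 → ℂ)} [IsProbabilityMeasure ν]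
    {η : Fin 4 → ℝ} (hν : Integrable (fun β : Fin 2 → ℂ =>
      Real.exp (2 * (‖weylCoeff η 0‖ * ‖β 0‖ + ‖weylCoeff η 1‖ * ‖β 1‖))) ν) :
    charFunction (coherentMixture ν) η = ∫ β : Fin 2 → ℂ,
      Complex.exp (-(weylCoeff η 0 * conj (weylCoeff η 0) +
          weylCoeff η 1 * conj (weylCoeff η 1)) / 2
        + Complex.I * ((weylCoeff η 0 * β 0 + weylCoeff η 1 * β 1) +
          conj (weylCoeff η 0 * β 0 + weylCoeff η 1 * β 1))) ∂ν := by
  set u := weylCoeff η with hu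
  -- These terms dominate those of the trace. In their sum the factor `exp(-|β|²)` cancels against
  -- the exponential series, leaving only linear growth in the exponent.
  have hsum (β : Fin 2 → ℂ) : HasSum (fun n : Fin 2 → ℕ =>
      Real.exp (-(‖β 0‖ ^ 2 + ‖β 1‖ ^ 2) + (‖u 0‖ * ‖β 0‖ + ‖u 1‖ * ‖β 1‖)) *
        ((‖β 0‖ * (‖β 0‖ + ‖u 0‖)) ^ n 0 / ((n 0).factorial : ℝ) *
        ((‖β 1‖ * (‖β 1‖ + ‖u 1‖)) ^ n 1 / ((n 1).factorial : ℝ))))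
      (Real.exp (2 * (‖u 0‖ * ‖β 0‖ + ‖u 1‖ * ‖β 1‖))) := by
    have h (x : ℝ) : HasSum (fun n : ℕ => x ^ n / (n.factorial : ℝ)) (Real.exp x) := by
      rw [Real.exp_eq_exp_ℝ]; exact NormedSpace.expSeries_div_hasSum_exp x
    have h' := (hasSum_mul_fin_two (h (‖β 0‖ * (‖β 0‖ + ‖u 0‖))) (h (‖β 1‖ * (‖β 1‖ + ‖u 1‖)))
      (h _).summable.norm (h _).summable.norm).mul_left
      (Real.exp (-(‖β 0‖ ^ 2 + ‖β 1‖ ^ 2) + (‖u 0‖ * ‖β 0‖ + ‖u 1‖ * ‖β 1‖)))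
    convert! h' using 1
    rw [← Real.exp_add, ← Real.exp_add]
    congr 1
    ring
  rw [charFunction]
  simp_rw [inner_coherentMixture, inner_ket]
  refine (hasSum_integral_of_dominated_convergence _ (fun n => ?_)
    (fun n => .of_forall fun β => ?_) (.of_forall fun β => (hsum β).summable) ?_
    (.of_forall fun β => ?_)).tsum_eq
  · have hc : Continuous fun β => coherent β n := by
      simp_rw [← inner_ket]; exact continuous_const.inner continuous_coherent
    exact (hc.mul (continuous_coherent.inner continuous_const)).aestronglyMeasurable
  · rw [coherent_mul_inner_weylKet, ← hu, norm_mul, norm_mul, norm_div, norm_div, norm_pow,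
      norm_pow, Complex.norm_natCast, Complex.norm_natCast, Complex.norm_exp]
    have hz (k : Fin 2) : ‖β k * (conj (β k) + Complex.I * u k)‖ ≤
        ‖β k‖ * (‖β k‖ + ‖u k‖) := by
      rw [norm_mul]
      gcongr
      refine (norm_add_le _ _).trans_eq ?_
      simp
    have hre : (Complex.I * (conj (u 0) * conj (β 0) + conj (u 1) * conj (β 1))).re ≤
        ‖u 0‖ * ‖β 0‖ + ‖u 1‖ * ‖β 1‖ := by
      refine (Complex.re_le_norm _).trans ?_
      rw [norm_mul, Complex.norm_I, one_mul]
      refine (norm_add_le _ _).trans_eq ?_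
      simp
    gcongr
    · rw [Complex.add_re, Complex.sub_re, Complex.mul_conj', Complex.mul_conj', Complex.mul_conj',
        Complex.mul_conj']
      have e1 : (-((‖β 0‖ : ℂ) ^ 2 + (‖β 1‖ : ℂ) ^ 2)).re = -(‖β 0‖ ^ 2 + ‖β 1‖ ^ 2) := by
        norm_cast
      have e2 : (((‖u 0‖ : ℂ) ^ 2 + (‖u 1‖ : ℂ) ^ 2) / 2).re = (‖u 0‖ ^ 2 + ‖u 1‖ ^ 2) / 2 := by
        norm_cast
      rw [e1, e2]
      have : 0 ≤ (‖u 0‖ ^ 2 + ‖u 1‖ ^ 2) / 2 := by positivity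
      linarith
    · exact hz 0
    · exact hz 1
  · simp_rw [(hsum _).tsum_eq]
    exact hν
  · simp_rw [coherent_mul_inner_weylKet, ← hu]
    have h := (hasSum_mul_fin_two
      (hasSum_pow_div_factorial (β 0 * (conj (β 0) + Complex.I * u 0)))
      (hasSum_pow_div_factorial (β 1 * (conj (β 1) + Complex.I * u 1)))
      (summable_norm_pow_div_factorial _) (summable_norm_pow_div_factorial _)).mul_left
      (Complex.exp (-(β 0 * conj (β 0) + β 1 * conj (β 1))
        - (u 0 * conj (u 0) + u 1 * conj (u 1)) / 2
        + Complex.I * (conj (u 0) * conj (β 0) + conj (u 1) * conj (β 1))))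
    convert! h using 1
    rw [← Complex.exp_add, ← Complex.exp_add, map_add, map_mul, map_mul]
    congr 1
    ring

section

/-! ### Separability of mixtures of coherent states -/

/-- Cauchy–Schwarz on the sum, then Bessel's inequality for each orthonormal family. -/
theorem traceNormLE_rankOne (x y : FockSpace) :
    TraceNormLE (InnerProductSpace.rankOne ℂ x y) (‖x‖ * ‖y‖) := by
  intro d u v hu hv
  have h1 := hu.sum_inner_products_le x (s := Finset.univ)
  have h2 := hv.sum_inner_products_le y (s := Finset.univ)
  calc ∑ i, ‖⟪u i, InnerProductSpace.rankOne ℂ x y (v i)⟫_ℂ‖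
      = ∑ i, ‖⟪u i, x⟫_ℂ‖ * ‖⟪v i, y⟫_ℂ‖ := by
        refine Finset.sum_congr rfl fun i _ => ?_
        rw [InnerProductSpace.inner_right_rankOne_apply, norm_mul, norm_inner_symm y]
    _ ≤ Real.sqrt (∑ i, ‖⟪u i, x⟫_ℂ‖ ^ 2) * Real.sqrt (∑ i, ‖⟪v i, y⟫_ℂ‖ ^ 2) :=
        Real.sum_mul_le_sqrt_mul_sqrt _ _ _
    _ ≤ Real.sqrt (‖x‖ ^ 2) * Real.sqrt (‖y‖ ^ 2) := by gcongr
    _ = ‖x‖ * ‖y‖ := by rw [Real.sqrt_sq (norm_nonneg _), Real.sqrt_sq (norm_nonneg _)]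

theorem TraceNormLE.add {S T : FockSpace →L[ℂ] FockSpace} {a b : ℝ} (hS : TraceNormLE S a)
    (hT : TraceNormLE T b) : TraceNormLE (S + T) (a + b) := by
  intro d u v hu hv
  refine le_trans ?_ (add_le_add (hS d u v hu hv) (hT d u v hu hv))
  rw [← Finset.sum_add_distrib]
  refine Finset.sum_le_sum fun i _ => ?_
  rw [add_apply, inner_add_right]
  exact norm_add_le _ _

/-- Split `|x⟩⟨x| - |y⟩⟨y| = |x - y⟩⟨x| + |y⟩⟨x - y|`. -/
theorem traceNormLE_rankOne_sub {x y : FockSpace} (hx : ‖x‖ = 1) (hy : ‖y‖ = 1) :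
    TraceNormLE (InnerProductSpace.rankOne ℂ x x - InnerProductSpace.rankOne ℂ y y)
      (2 * ‖x - y‖) := by
  have h := (traceNormLE_rankOne (x - y) x).add (traceNormLE_rankOne y (x - y))
  rw [hx, hy, one_mul, mul_one, ← two_mul] at h
  convert! h using 1
  simp

theorem traceNormLE_integral {Ω : Type*} [MeasurableSpace Ω] {μ : Measure Ω}
    {F : Ω → FockSpace →L[ℂ] FockSpace} {c : Ω → ℝ} (hF : Integrable F μ) (hc : Integrable c μ)
    (h : ∀ ω, TraceNormLE (F ω) (c ω)) : TraceNormLE (∫ ω, F ω ∂μ) (∫ ω, c ω ∂μ) := by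
  intro d u v hu hv
  have hi (i : Fin d) : Integrable (fun ω => ⟪u i, F ω (v i)⟫_ℂ) μ :=
    (hF.apply_continuousLinearMap (v i)).const_inner (u i)
  calc ∑ i, ‖⟪u i, (∫ ω, F ω ∂μ) (v i)⟫_ℂ‖ = ∑ i, ‖∫ ω, ⟪u i, F ω (v i)⟫_ℂ ∂μ‖ := by
        refine Finset.sum_congr rfl fun i _ => ?_
        rw [ContinuousLinearMap.integral_apply hF,
          ← integral_inner (hF.apply_continuousLinearMap (v i))]
    _ ≤ ∑ i, ∫ ω, ‖⟪u i, F ω (v i)⟫_ℂ‖ ∂μ :=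
        Finset.sum_le_sum fun i _ => norm_integral_le_integral_norm _
    _ = ∫ ω, ∑ i, ‖⟪u i, F ω (v i)⟫_ℂ‖ ∂μ := (integral_finsetSum _ fun i _ => (hi i).norm).symm
    _ ≤ ∫ ω, c ω ∂μ :=
        integral_mono (integrable_finsetSum _ fun i _ => (hi i).norm) hc fun ω => h ω d u v hu hv

/-- The integral is a finite sum weighted by the measures of the fibres, which add up to one. -/
theorem integral_simpleFunc_mem_convexHull {Ω E : Type*} [MeasurableSpace Ω] {μ : Measure Ω}
    [IsProbabilityMeasure μ] [NormedAddCommGroup E] [NormedSpace ℝ E] [CompleteSpace E]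
    {f : SimpleFunc Ω E} {s : Set E} (hf : ∀ ω, f ω ∈ s) (hi : Integrable f μ) :
    ∫ ω, f ω ∂μ ∈ convexHull ℝ s := by
  rw [SimpleFunc.integral_eq_sum f hi]
  refine (convex_convexHull ℝ s).sum_mem (fun _ _ => measureReal_nonneg) ?_ fun y hy => ?_
  · rw [sum_measureReal_preimage_singleton _ fun y _ => f.measurableSet_fiber y,
      SimpleFunc.coe_range, Set.preimage_range, probReal_univ]
  · obtain ⟨ω, rfl⟩ := SimpleFunc.mem_range.1 hy
    exact subset_convexHull ℝ s (hf ω)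

variable {ν : Measure (Fin 2 → ℂ)}

theorem isDensity_coherentMixture [IsProbabilityMeasure ν] : IsDensity (coherentMixture ν) := by
  refine ⟨isPositive_coherentMixture, ?_⟩
  have h := hasSum_integral_mul_coherent (ν := ν) (f := fun _ => 1) (integrable_const _)
  simp only [one_mul, ← matrixElement_coherentMixture, integral_const, probReal_univ,
    one_smul] at h
  exact h

theorem aestronglyMeasurable_norm_coherent_sub (s : SimpleFunc (Fin 2 → ℂ) (Fin 2 → ℂ)) :
    AEStronglyMeasurable (fun β => 2 * ‖coherent β - coherent (s β)‖) ν :=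
  ((continuous_coherent.aestronglyMeasurable.sub
    (s.map coherent).aestronglyMeasurable).norm).const_mul 2

theorem norm_norm_coherent_sub_le (β γ : Fin 2 → ℂ) : ‖2 * ‖coherent β - coherent γ‖‖ ≤ 4 := by
  have := norm_sub_le (coherent β) (coherent γ)
  rw [norm_coherent, norm_coherent] at this
  rw [Real.norm_of_nonneg (by positivity)]
  linarith

/-- Simple functions converge pointwise to the identity; continuity of `coherent` and the uniform
bound `4` give dominated convergence. -/
theorem exists_simpleFunc_integral_norm_coherent_sub_lt [IsProbabilityMeasure ν]
    {ε : ℝ} (hε : 0 < ε) :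
    ∃ s : SimpleFunc (Fin 2 → ℂ) (Fin 2 → ℂ),
      ∫ β, 2 * ‖coherent β - coherent (s β)‖ ∂ν < ε := by
  let s (n : ℕ) : SimpleFunc (Fin 2 → ℂ) (Fin 2 → ℂ) :=
    SimpleFunc.approxOn id measurable_id Set.univ 0 (Set.mem_univ 0) n
  have hs (β) : Filter.Tendsto (fun n => s n β) Filter.atTop (nhds β) :=
    SimpleFunc.tendsto_approxOn measurable_id (Set.mem_univ 0) (by simp)
  have hlim : Filter.Tendsto (fun n => ∫ β, 2 * ‖coherent β - coherent (s n β)‖ ∂ν)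
      Filter.atTop (nhds (∫ _, (0 : ℝ) ∂ν)) := by
    refine tendsto_integral_of_dominated_convergence (fun _ => 4)
      (fun n => aestronglyMeasurable_norm_coherent_sub (s n)) (integrable_const _)
      (fun n => .of_forall fun β => norm_norm_coherent_sub_le β (s n β)) (.of_forall fun β => ?_)
    have h := ((continuous_coherent.tendsto β).comp (hs β)).const_sub (coherent β)
    simpa using h.norm.const_mul 2
  rw [integral_zero] at hlim
  obtain ⟨n, hn⟩ := (hlim.eventually_lt_const hε).exists
  exact ⟨s n, hn⟩

theorem integrable_map_rankOne_coherent [IsProbabilityMeasure ν]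
    (s : SimpleFunc (Fin 2 → ℂ) (Fin 2 → ℂ)) :
    Integrable (s.map fun β => InnerProductSpace.rankOne ℂ (coherent β) (coherent β)) ν :=
  Integrable.of_bound (SimpleFunc.aestronglyMeasurable _) 1 (.of_forall fun β => by
    rw [SimpleFunc.map_apply, InnerProductSpace.norm_rankOne, norm_coherent, one_mul])

theorem traceNormLE_coherentMixture_sub [IsProbabilityMeasure ν]
    (s : SimpleFunc (Fin 2 → ℂ) (Fin 2 → ℂ)) :
    TraceNormLE (coherentMixture ν - ∫ β, (s.map fun β =>
      InnerProductSpace.rankOne ℂ (coherent β) (coherent β)) β ∂ν)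
      (∫ β, 2 * ‖coherent β - coherent (s β)‖ ∂ν) := by
  rw [coherentMixture,
    ← integral_sub integrable_rankOne_coherent (integrable_map_rankOne_coherent s)]
  refine traceNormLE_integral
    (integrable_rankOne_coherent.sub (integrable_map_rankOne_coherent s))
    (Integrable.of_bound (aestronglyMeasurable_norm_coherent_sub s) 4
      (.of_forall fun β => norm_norm_coherent_sub_le β (s β))) ?_
  intro β
  rw [SimpleFunc.map_apply]
  exact traceNormLE_rankOne_sub (norm_coherent β) (norm_coherent (s β))

/-- Replacing `β` by a simple function of `β` makes the mixture a finite convex combination of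
product states, at a trace-norm cost of at most the mean of `2 ‖coherent β - coherent (s β)‖`. -/
theorem isSeparableState_coherentMixture [IsProbabilityMeasure ν] :
    IsSeparableState (coherentMixture ν) := by
  refine ⟨isDensity_coherentMixture, fun ε hε => ?_⟩
  obtain ⟨s, hs⟩ := exists_simpleFunc_integral_norm_coherent_sub_lt (ν := ν) hε
  refine ⟨_, integral_simpleFunc_mem_convexHull (fun β => ?_)
    (integrable_map_rankOne_coherent s), fun d u v hu hv =>
      (traceNormLE_coherentMixture_sub s d u v hu hv).trans hs.le⟩
  exact isProductState_coherent (s β)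

end

open ProbabilityTheory

/-! ### Standard Gaussian vectors -/

/-- The law of a vector of independent standard Gaussian random variables. -/
def stdGaussianPi (ι : Type) [Fintype ι] : Measure (ι → ℝ) :=
  Measure.pi fun _ => gaussianReal 0 1

section
variable {ι : Type} [Fintype ι]

instance : IsProbabilityMeasure (stdGaussianPi ι) := by
  unfold stdGaussianPi; infer_instance

theorem memLp_eval_stdGaussianPi (i : ι) : MemLp (fun g : ι → ℝ => g i) 2 (stdGaussianPi ι) :=
  (memLp_id_gaussianReal' 2 (by norm_num)).comp_measurePreserving
    (measurePreserving_eval (fun _ : ι => gaussianReal 0 1) i)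

theorem integrable_eval_stdGaussianPi (i : ι) :
    Integrable (fun g : ι → ℝ => g i) (stdGaussianPi ι) :=
  (memLp_eval_stdGaussianPi i).integrable (by norm_num)

theorem integrable_eval_mul_eval_stdGaussianPi (i j : ι) :
    Integrable (fun g : ι → ℝ => g i * g j) (stdGaussianPi ι) :=
  (memLp_eval_stdGaussianPi i).integrable_mul (memLp_eval_stdGaussianPi j)

theorem integral_eval_stdGaussianPi (i : ι) : ∫ g, g i ∂(stdGaussianPi ι) = 0 := by
  have h := integral_comp_eval (μ := fun _ : ι => gaussianReal 0 1) (i := i) (f := fun x : ℝ => x)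
    aestronglyMeasurable_id
  rw [stdGaussianPi, h, integral_id_gaussianReal]

theorem integral_sq_gaussianReal : ∫ x, x * x ∂(gaussianReal 0 1) = 1 := by
  have h := variance_id_gaussianReal (μ := 0) (v := 1)
  rw [variance_of_integral_eq_zero aemeasurable_id (by simp [integral_id_gaussianReal])] at h
  simpa [sq] using h

theorem integral_eval_mul_eval_stdGaussianPi [DecidableEq ι] (i j : ι) :
    ∫ g, g i * g j ∂(stdGaussianPi ι) = if i = j then 1 else 0 := by
  split_ifs with hij
  · subst hij
    have h := integral_comp_eval (μ := fun _ : ι => gaussianReal 0 1) (i := i)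
      (f := fun x : ℝ => x * x) (by fun_prop)
    rw [stdGaussianPi, h, integral_sq_gaussianReal]
  -- Writing `g i * g j` as a product over all coordinates makes Fubini applicable; for `i ≠ j` the
  -- factor at `i` is the mean, which is zero.
  · have h := integral_fintype_prod_eq_prod (𝕜 := ℝ) (μ := fun _ : ι => gaussianReal 0 1)
      (fun m x => (if m = i then x else 1) * (if m = j then x else 1))
    simp only [Finset.prod_mul_distrib, Finset.prod_ite_eq', Finset.mem_univ, if_true] at h
    rw [stdGaussianPi, h]
    refine Finset.prod_eq_zero (Finset.mem_univ i) ?_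
    simp [hij, integral_id_gaussianReal]

theorem integrable_exp_sum_stdGaussianPi (c : ι → ℝ) :
    Integrable (fun g : ι → ℝ => Real.exp (∑ i, c i * |g i|)) (stdGaussianPi ι) := by
  simp_rw [Real.exp_sum]
  refine Integrable.fintype_prod (f := fun i x => Real.exp (c i * |x|)) fun i => ?_
  exact integrable_exp_mul_abs (integrable_exp_mul_gaussianReal _)
    (integrable_exp_mul_gaussianReal _)

theorem integral_exp_sum_stdGaussianPi (c : ι → ℝ) :
    ∫ g : ι → ℝ, Complex.exp (Complex.I * ∑ i, (c i : ℂ) * (g i : ℂ)) ∂(stdGaussianPi ι) =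
      Complex.exp (-(∑ i, (c i : ℂ) ^ 2) / 2) := by
  have h1 (i : ι) : ∫ x : ℝ, Complex.exp (Complex.I * ((c i : ℂ) * (x : ℂ))) ∂(gaussianReal 0 1) =
      Complex.exp (-(c i : ℂ) ^ 2 / 2) := by
    have h := charFun_gaussianReal (μ := 0) (v := 1) (c i)
    rw [charFun_apply_real] at h
    simp only [mul_comm Complex.I]
    rw [h]
    congr 1
    simp
    ring
  simp_rw [Finset.mul_sum, Complex.exp_sum]
  rw [stdGaussianPi, integral_fintype_prod_eq_prod (𝕜 := ℂ) (μ := fun _ : ι => gaussianReal 0 1)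
    (fun i (x : ℝ) => Complex.exp (Complex.I * ((c i : ℂ) * (x : ℂ))))]
  simp_rw [h1, ← Complex.exp_sum, ← Finset.sum_div, Finset.sum_neg_distrib]

/-- The complex affine form `a + ∑ d_i g_i`. -/
def affineForm (a : ℂ) (d : ι → ℂ) (g : ι → ℝ) : ℂ := a + ∑ i, d i * (g i : ℂ)

theorem continuous_affineForm (a : ℂ) (d : ι → ℂ) : Continuous (affineForm a d) := by
  unfold affineForm; fun_prop

theorem conj_affineForm (a : ℂ) (d : ι → ℂ) (g : ι → ℝ) :
    conj (affineForm a d g) = affineForm (conj a) (fun i => conj (d i)) g := by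
  simp [affineForm]

theorem norm_affineForm_le (a : ℂ) (d : ι → ℂ) (g : ι → ℝ) :
    ‖affineForm a d g‖ ≤ ‖a‖ + ∑ i, ‖d i‖ * |g i| := by
  refine (norm_add_le _ _).trans (add_le_add_right ((norm_sum_le _ _).trans_eq ?_) _)
  simp

theorem memLp_affineForm (a : ℂ) (d : ι → ℂ) : MemLp (affineForm a d) 2 (stdGaussianPi ι) := by
  refine (memLp_const a).add (memLp_finsetSum _ fun i _ => ?_)
  exact ((memLp_eval_stdGaussianPi i).ofReal (K := ℂ)).const_mul (d i)

theorem integrable_affineForm (a : ℂ) (d : ι → ℂ) :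
    Integrable (affineForm a d) (stdGaussianPi ι) :=
  (memLp_affineForm a d).integrable (by norm_num)

theorem integrable_affineForm_mul (a b : ℂ) (d e : ι → ℂ) :
    Integrable (fun g => affineForm a d g * affineForm b e g) (stdGaussianPi ι) :=
  (memLp_affineForm a d).integrable_mul (memLp_affineForm b e)

theorem integral_affineForm (a : ℂ) (d : ι → ℂ) :
    ∫ g, affineForm a d g ∂(stdGaussianPi ι) = a := by
  have hi (i : ι) : Integrable (fun g : ι → ℝ => d i * (g i : ℂ)) (stdGaussianPi ι) :=
    ((integrable_eval_stdGaussianPi i).ofReal (𝕜 := ℂ)).const_mul (d i)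
  unfold affineForm
  rw [integral_add (integrable_const _) (integrable_finsetSum _ fun i _ => hi i),
    integral_finsetSum _ fun i _ => hi i]
  simp only [integral_const_mul, integral_complex_ofReal, integral_eval_stdGaussianPi]
  simp

theorem integral_affineForm_mul (a b : ℂ) (d e : ι → ℂ) :
    ∫ g, affineForm a d g * affineForm b e g ∂(stdGaussianPi ι) = a * b + ∑ i, d i * e i := by
  classical
  have hij (i j : ι) : Integrable (fun g : ι → ℝ => d i * e j * ((g i * g j : ℝ) : ℂ))
      (stdGaussianPi ι) :=
    ((integrable_eval_mul_eval_stdGaussianPi i j).ofReal (𝕜 := ℂ)).const_mul _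
  have hs : Integrable (fun g : ι → ℝ => ∑ i, ∑ j, d i * e j * ((g i * g j : ℝ) : ℂ))
      (stdGaussianPi ι) :=
    integrable_finsetSum _ fun i _ => integrable_finsetSum _ fun j _ => hij i j
  have hexp (g : ι → ℝ) : affineForm a d g * affineForm b e g =
      affineForm (a * b) (fun i => a * e i + b * d i) g +
        ∑ i, ∑ j, d i * e j * ((g i * g j : ℝ) : ℂ) := by
    have : (∑ i, d i * (g i : ℂ)) * (∑ j, e j * (g j : ℂ)) =
        ∑ i, ∑ j, d i * e j * ((g i * g j : ℝ) : ℂ) := by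
      rw [Finset.sum_mul_sum]
      refine Finset.sum_congr rfl fun i _ => Finset.sum_congr rfl fun j _ => ?_
      push_cast; ring
    rw [← this]
    simp only [affineForm, add_mul, Finset.sum_add_distrib, mul_assoc, ← Finset.mul_sum]
    ring
  simp_rw [hexp]
  rw [integral_add (integrable_affineForm _ _) hs, integral_affineForm,
    integral_finsetSum _ fun i _ => integrable_finsetSum _ fun j _ => hij i j]
  congr 1
  refine Finset.sum_congr rfl fun i _ => ?_
  rw [integral_finsetSum _ fun j _ => hij i j]
  simp_rw [integral_const_mul, integral_complex_ofReal, integral_eval_mul_eval_stdGaussianPi]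
  rw [Finset.sum_eq_single i (fun j _ hj => by rw [if_neg hj.symm]; simp)
    (fun h => absurd (Finset.mem_univ i) h)]
  simp

/-- The exponent is a real Gaussian with coefficients `d i + conj (d i)`. The hypothesis `hd` is
circularity: it cancels the squares of `d` and of its conjugate, leaving variance `2 ∑ |d i|²`. -/
theorem integral_exp_affineForm_add_conj (a : ℂ) (d : ι → ℂ) (hd : ∑ i, d i * d i = 0) :
    ∫ g, Complex.exp (Complex.I * (affineForm a d g + conj (affineForm a d g)))
      ∂(stdGaussianPi ι) =
      Complex.exp (Complex.I * (a + conj a) - ∑ i, d i * conj (d i)) := by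
  have h := integral_exp_sum_stdGaussianPi fun i => 2 * (d i).re
  have hc (i : ι) : (((2 * (d i).re : ℝ)) : ℂ) = d i + conj (d i) := (Complex.add_conj _).symm
  have hd' : ∑ i, conj (d i) * conj (d i) = 0 := by
    simpa using congrArg conj hd
  have hexp (g : ι → ℝ) :
      Complex.exp (Complex.I * (affineForm a d g + conj (affineForm a d g))) =
      Complex.exp (Complex.I * (a + conj a)) *
        Complex.exp (Complex.I * ∑ i, (((2 * (d i).re : ℝ)) : ℂ) * (g i : ℂ)) := by
    rw [← Complex.exp_add, conj_affineForm]
    congr 1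
    simp only [hc, affineForm, add_mul, Finset.sum_add_distrib]
    ring
  rw [integral_congr_ae (.of_forall hexp), integral_const_mul, h, ← Complex.exp_add]
  congr 1
  have : ∑ i, (((2 * (d i).re : ℝ)) : ℂ) ^ 2 = 2 * ∑ i, d i * conj (d i) := by
    have e (i : ι) : (((2 * (d i).re : ℝ)) : ℂ) ^ 2 =
        d i * d i + conj (d i) * conj (d i) + 2 * (d i * conj (d i)) := by rw [hc]; ring
    simp_rw [e, Finset.sum_add_distrib, hd, hd', ← Finset.mul_sum]
    ring
  rw [this]
  ring

end

/-! ### Gaussian mixtures of coherent states -/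

/-- The coefficients of the circularly symmetric Gaussian vector `B ζ`, where `ζ_l` are independent
standard complex Gaussian variables, in terms of independent standard real ones. -/
def circularCoeff (B : Matrix (Fin 2) (Fin 2) ℂ) (k : Fin 2) : Fin 2 ⊕ Fin 2 → ℂ :=
  Sum.elim (fun l => B k l / (Real.sqrt 2 : ℝ)) (fun l => Complex.I * (B k l / (Real.sqrt 2 : ℝ)))

theorem sqrt_two_mul_self : ((Real.sqrt 2 : ℝ) : ℂ) * ((Real.sqrt 2 : ℝ) : ℂ) = 2 := by
  rw [ofReal_sqrt_mul_self (by norm_num)]; norm_num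

/-- The real and imaginary parts of each `ζ_l` contribute with opposite signs, as `1 + I² = 0`. This
makes the centred anomalous moments vanish. -/
theorem sum_circularCoeff_mul (B : Matrix (Fin 2) (Fin 2) ℂ) (k k' : Fin 2) :
    ∑ i, circularCoeff B k i * circularCoeff B k' i = 0 := by
  simp only [circularCoeff, Fintype.sum_sum_type, Sum.elim_inl, Sum.elim_inr, Fin.sum_univ_two]
  ring_nf
  simp only [Complex.I_sq]
  ring

theorem sum_circularCoeff_mul_conj (B : Matrix (Fin 2) (Fin 2) ℂ) (k k' : Fin 2) :
    ∑ i, circularCoeff B k i * conj (circularCoeff B k' i) = (B * B.conjTranspose) k k' := by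
  have h (x y : ℂ) : x / (Real.sqrt 2 : ℝ) * (y / (Real.sqrt 2 : ℝ)) = x * y / 2 := by
    rw [div_mul_div_comm, sqrt_two_mul_self]
  simp only [circularCoeff, Fintype.sum_sum_type, Sum.elim_inl, Sum.elim_inr, Fin.sum_univ_two,
    Matrix.mul_apply, Matrix.conjTranspose_apply, map_mul, map_div₀, Complex.conj_I,
    Complex.conj_ofReal, mul_mul_mul_comm Complex.I, h, RCLike.star_def]
  ring_nf
  simp only [Complex.I_sq]
  ring

/-- The law of the complex Gaussian vector with mean `α` and covariance matrix `B Bᴴ`. -/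
def complexGaussian (α : Fin 2 → ℂ) (B : Matrix (Fin 2) (Fin 2) ℂ) : Measure (Fin 2 → ℂ) :=
  (stdGaussianPi (Fin 2 ⊕ Fin 2)).map fun g k => affineForm (α k) (circularCoeff B k) g

section
variable (α : Fin 2 → ℂ) (B : Matrix (Fin 2) (Fin 2) ℂ)

theorem continuous_affineForm_circular :
    Continuous fun (g : Fin 2 ⊕ Fin 2 → ℝ) (k : Fin 2) =>
      affineForm (α k) (circularCoeff B k) g :=
  continuous_pi fun _ => continuous_affineForm _ _

instance : IsProbabilityMeasure (complexGaussian α B) :=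
  Measure.isProbabilityMeasure_map (continuous_affineForm_circular α B).aemeasurable

variable {E : Type*} [NormedAddCommGroup E] {f : (Fin 2 → ℂ) → E}

theorem integrable_complexGaussian_iff (hf : Continuous f) [SecondCountableTopology E] :
    Integrable f (complexGaussian α B) ↔
      Integrable (fun g => f fun k => affineForm (α k) (circularCoeff B k) g)
        (stdGaussianPi (Fin 2 ⊕ Fin 2)) :=
  integrable_map_measure hf.aestronglyMeasurable (continuous_affineForm_circular α B).aemeasurable

theorem integral_complexGaussian [NormedSpace ℝ E] [SecondCountableTopology E] (hf : Continuous f) :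
    ∫ β, f β ∂(complexGaussian α B) =
      ∫ g, f (fun k => affineForm (α k) (circularCoeff B k) g)
        ∂(stdGaussianPi (Fin 2 ⊕ Fin 2)) :=
  integral_map (continuous_affineForm_circular α B).aemeasurable hf.aestronglyMeasurable

theorem ladderMoments_complexGaussian :
    LadderMoments (coherentMixture (complexGaussian α B)) α
      (Matrix.of fun k k' => α k * conj (α k') + (B * B.conjTranspose) k k')
      (Matrix.of fun k k' => α k * α k') := by
  have c1 (k : Fin 2) : Continuous fun β : Fin 2 → ℂ => β k := continuous_apply k
  have c2 (k k' : Fin 2) : Continuous fun β : Fin 2 → ℂ => β k * β k' := (c1 k).mul (c1 k')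
  have c3 (k k' : Fin 2) : Continuous fun β : Fin 2 → ℂ => β k * conj (β k') :=
    (c1 k).mul (Complex.continuous_conj.comp (c1 k'))
  have h := ladderMoments_coherentMixture (ν := complexGaussian α B)
    (fun k => (integrable_complexGaussian_iff α B (c1 k)).2 (integrable_affineForm _ _))
    (fun k k' => (integrable_complexGaussian_iff α B (c2 k k')).2 (integrable_affineForm_mul ..))
    (fun k k' => (integrable_complexGaussian_iff α B (c3 k k')).2
      (by simp_rw [conj_affineForm]; exact integrable_affineForm_mul ..))
  simp only [integral_complexGaussian α B (c1 _), integral_complexGaussian α B (c2 _ _),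
    integral_complexGaussian α B (c3 _ _), conj_affineForm, integral_affineForm,
    integral_affineForm_mul, sum_circularCoeff_mul, sum_circularCoeff_mul_conj, add_zero] at h
  exact h

/-- Supplies the exponential moments required by `charFunction_coherentMixture`: an affine form
grows linearly in the `|g i|`. -/
theorem integrable_exp_complexGaussian (c d : ℝ) (hc : 0 ≤ c) (hd : 0 ≤ d) :
    Integrable (fun β : Fin 2 → ℂ => Real.exp (2 * (c * ‖β 0‖ + d * ‖β 1‖)))
      (complexGaussian α B) := by
  have hcont : Continuous fun β : Fin 2 → ℂ => Real.exp (2 * (c * ‖β 0‖ + d * ‖β 1‖)) := by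
    fun_prop
  rw [integrable_complexGaussian_iff α B hcont]
  refine ((integrable_exp_sum_stdGaussianPi fun i : Fin 2 ⊕ Fin 2 =>
    2 * (c * ‖circularCoeff B 0 i‖ + d * ‖circularCoeff B 1 i‖)).const_mul
      (Real.exp (2 * (c * ‖α 0‖ + d * ‖α 1‖)))).mono'
    (hcont.comp (continuous_affineForm_circular α B)).aestronglyMeasurable
    (.of_forall fun g => ?_)
  rw [Real.norm_of_nonneg (Real.exp_pos _).le, ← Real.exp_add, Real.exp_le_exp]
  have h0 := mul_le_mul_of_nonneg_left (norm_affineForm_le (α 0) (circularCoeff B 0) g) hc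
  have h1 := mul_le_mul_of_nonneg_left (norm_affineForm_le (α 1) (circularCoeff B 1) g) hd
  have e : ∑ i, 2 * (c * ‖circularCoeff B 0 i‖ + d * ‖circularCoeff B 1 i‖) * |g i| =
      2 * (c * ∑ i, ‖circularCoeff B 0 i‖ * |g i| + d * ∑ i, ‖circularCoeff B 1 i‖ * |g i|) := by
    rw [Finset.mul_sum, Finset.mul_sum, ← Finset.sum_add_distrib, Finset.mul_sum]
    exact Finset.sum_congr rfl fun i _ => by ring
  rw [e]
  linarith

/-- The summand `1 / 2` on the diagonal is the vacuum factor `exp(-|u|²/2)`; the rest is the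
characteristic function of the classical Gaussian law. -/
theorem charFunction_complexGaussian (η : Fin 4 → ℝ) :
    charFunction (coherentMixture (complexGaussian α B)) η =
      Complex.exp (Complex.I * ((weylCoeff η 0 * α 0 + weylCoeff η 1 * α 1) +
          conj (weylCoeff η 0 * α 0 + weylCoeff η 1 * α 1)) -
        ∑ k, ∑ k', weylCoeff η k * conj (weylCoeff η k') *
          ((B * B.conjTranspose) k k' + if k = k' then 1 / 2 else 0)) := by
  rw [charFunction_coherentMixture
    (integrable_exp_complexGaussian α B _ _ (norm_nonneg _) (norm_nonneg _))]
  have := Complex.continuous_conj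
  rw [integral_complexGaussian α B (by fun_prop)]
  set u := weylCoeff η
  set d : Fin 2 ⊕ Fin 2 → ℂ := fun i => u 0 * circularCoeff B 0 i + u 1 * circularCoeff B 1 i
    with hd
  have haff (g : Fin 2 ⊕ Fin 2 → ℝ) : u 0 * affineForm (α 0) (circularCoeff B 0) g +
      u 1 * affineForm (α 1) (circularCoeff B 1) g = affineForm (u 0 * α 0 + u 1 * α 1) d g := by
    simp only [affineForm, hd, add_mul, Finset.sum_add_distrib, mul_assoc, ← Finset.mul_sum]
    ring
  have hdd : ∑ i, d i * d i = 0 := by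
    have e (i) : d i * d i = u 0 * u 0 * (circularCoeff B 0 i * circularCoeff B 0 i) +
        2 * (u 0 * u 1) * (circularCoeff B 0 i * circularCoeff B 1 i) +
        u 1 * u 1 * (circularCoeff B 1 i * circularCoeff B 1 i) := by rw [hd]; ring
    simp_rw [e, Finset.sum_add_distrib, ← Finset.mul_sum, sum_circularCoeff_mul]
    ring
  have hdc : ∑ i, d i * conj (d i) =
      ∑ k, ∑ k', u k * conj (u k') * (B * B.conjTranspose) k k' := by
    have e (i) : d i * conj (d i) =
        u 0 * conj (u 0) * (circularCoeff B 0 i * conj (circularCoeff B 0 i)) +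
        u 0 * conj (u 1) * (circularCoeff B 0 i * conj (circularCoeff B 1 i)) +
        (u 1 * conj (u 0) * (circularCoeff B 1 i * conj (circularCoeff B 0 i)) +
        u 1 * conj (u 1) * (circularCoeff B 1 i * conj (circularCoeff B 1 i))) := by
      simp only [hd, map_add, map_mul]; ring
    simp_rw [e, Finset.sum_add_distrib, ← Finset.mul_sum, sum_circularCoeff_mul_conj,
      Fin.sum_univ_two]
  simp_rw [haff, Complex.exp_add (-(u 0 * conj (u 0) + u 1 * conj (u 1)) / 2)]
  rw [integral_const_mul, integral_exp_affineForm_add_conj _ _ hdd, hdc, ← Complex.exp_add]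
  congr 1
  simp [Fin.sum_univ_two]
  ring

end

theorem dotProduct_firstMoments {ρ : FockSpace →L[ℂ] FockSpace} {α : Fin 2 → ℂ}
    {r s : Matrix (Fin 2) (Fin 2) ℂ} (h : LadderMoments ρ α r s) (η : Fin 4 → ℝ) :
    ((η ⬝ᵥ firstMoments ρ : ℝ) : ℂ) = (weylCoeff η 0 * α 0 + weylCoeff η 1 * α 1) +
      conj (weylCoeff η 0 * α 0 + weylCoeff η 1 * α 1) := by
  have e (l : Fin 4) : ((firstMoments ρ l : ℝ) : ℂ) =
      quadratureCoeff l * α (quadratureMode l) +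
        conj (quadratureCoeff l * α (quadratureMode l)) := by
    rw [h.firstMoments_apply, Complex.add_conj]
  simp only [dotProduct, Complex.ofReal_add, Complex.ofReal_mul, e, Fin.sum_univ_four, weylCoeff,
    show quadratureMode 0 = 0 from rfl, show quadratureMode 1 = 0 from rfl,
    show quadratureMode 2 = 1 from rfl, show quadratureMode 3 = 1 from rfl,
    Matrix.cons_val_zero, Matrix.cons_val_one, map_add, map_mul, Complex.conj_ofReal]
  ring

/-- By `hs` only the Hermitian form of the centred `r` plus vacuum noise survives, matching the
exponent in `charFunction_complexGaussian`. -/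
theorem dotProduct_covarianceMatrix {ρ : FockSpace →L[ℂ] FockSpace} {α : Fin 2 → ℂ}
    {r s : Matrix (Fin 2) (Fin 2) ℂ} (h : LadderMoments ρ α r s)
    (hs : ∀ k k', s k k' = α k * α k') (η : Fin 4 → ℝ) :
    ((η ⬝ᵥ (covarianceMatrix ρ).mulVec η : ℝ) : ℂ) =
      2 * ∑ k, ∑ k', weylCoeff η k * conj (weylCoeff η k') *
          (r k k' - α k * conj (α k') + if k = k' then 1 / 2 else 0) := by
  have e (l m : Fin 4) : ((covarianceMatrix ρ l m : ℝ) : ℂ) =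
      quadratureCoeff l * conj (quadratureCoeff m) *
        (r (quadratureMode l) (quadratureMode m) - α (quadratureMode l) *
          conj (α (quadratureMode m)) + if quadratureMode l = quadratureMode m then 1 / 2 else 0) +
      quadratureCoeff m * conj (quadratureCoeff l) *
        (r (quadratureMode m) (quadratureMode l) - α (quadratureMode m) *
          conj (α (quadratureMode l)) +
            if quadratureMode m = quadratureMode l then 1 / 2 else 0) := by
    rw [h.covarianceMatrix_apply, hs, sub_self, mul_zero, zero_add, ← Complex.add_conj,
      ← h.conj_particle (quadratureMode l) (quadratureMode m)]
    congr 1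
    split_ifs with h1 h2 h2
    · simp [Complex.conj_ofNat]; ring
    · exact absurd h1.symm h2
    · exact absurd h2.symm h1
    · simp; ring
  simp only [dotProduct, Matrix.mulVec, Complex.ofReal_add, Complex.ofReal_mul, e,
    Fin.sum_univ_four, Fin.sum_univ_two, weylCoeff,
    show quadratureMode 0 = 0 from rfl, show quadratureMode 1 = 0 from rfl,
    show quadratureMode 2 = 1 from rfl, show quadratureMode 3 = 1 from rfl,
    Matrix.cons_val_zero, Matrix.cons_val_one, map_add, map_mul, Complex.conj_ofReal, if_true,
    zero_ne_one, one_ne_zero, if_false, add_zero]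
  ring

theorem isGaussian_complexGaussian (α : Fin 2 → ℂ) (B : Matrix (Fin 2) (Fin 2) ℂ) :
    IsGaussian (coherentMixture (complexGaussian α B)) := by
  have h := ladderMoments_complexGaussian α B
  refine ⟨isDensity_coherentMixture, h.finiteMeanNumber, fun η => ?_⟩
  rw [charFunction_complexGaussian, dotProduct_firstMoments h,
    dotProduct_covarianceMatrix h (fun _ _ => rfl)]
  simp only [Matrix.of_apply, add_sub_cancel_left]
  congr 2
  ring

/-! ### Covariance matrices in standard form -/

theorem quadratureCoeff_mul_conj (l m : Fin 4) : quadratureCoeff l * conj (quadratureCoeff m) =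
    (![1, -Complex.I, 1, -Complex.I] l * conj (![1, -Complex.I, 1, -Complex.I] m)) / 2 := by
  have h := sqrt_two_mul_self
  have e (i : Fin 4) :
      quadratureCoeff i = ![1, -Complex.I, 1, -Complex.I] i / (Real.sqrt 2 : ℝ) := by
    fin_cases i <;> simp [quadratureCoeff]
  rw [e, e, map_div₀, Complex.conj_ofReal, div_mul_div_comm, h]

theorem quadratureCoeff_mul (l m : Fin 4) : quadratureCoeff l * quadratureCoeff m =
    (![1, -Complex.I, 1, -Complex.I] l * ![1, -Complex.I, 1, -Complex.I] m) / 2 := by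
  have h := sqrt_two_mul_self
  have e (i : Fin 4) :
      quadratureCoeff i = ![1, -Complex.I, 1, -Complex.I] i / (Real.sqrt 2 : ℝ) := by
    fin_cases i <;> simp [quadratureCoeff]
  rw [e, e, div_mul_div_comm, h]

open scoped MatrixOrder ComplexOrder in
theorem exists_conjTranspose_mul_self_eq {n : Type*} [Fintype n] [DecidableEq n]
    {A : Matrix n n ℂ} (hA : A.PosSemidef) : ∃ C : Matrix n n ℂ, A = C.conjTranspose * C :=
  CStarAlgebra.nonneg_iff_eq_star_mul_self.1 hA.nonneg

/-- The correlation matrix of a state whose covariance matrix has the standard form. -/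
theorem LadderMoments.of_standardForm {ρ : FockSpace →L[ℂ] FockSpace} {α : Fin 2 → ℂ}
    {r s : Matrix (Fin 2) (Fin 2) ℂ} (h : LadderMoments ρ α r s) {a b cp cm : ℝ}
    (hV : covarianceMatrix ρ = standardForm a b cp cm) :
    r 0 0 - α 0 * conj (α 0) = ((a - 1 / 2 : ℝ) : ℂ) ∧
    r 1 1 - α 1 * conj (α 1) = ((b - 1 / 2 : ℝ) : ℂ) ∧
    r 0 1 - α 0 * conj (α 1) = (((cp + cm) / 2 : ℝ) : ℂ) := by
  have e (l m : Fin 4) := (congrFun (congrFun hV l) m).symm.trans (h.covarianceMatrix_apply l m)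
  simp only [quadratureCoeff_mul, quadratureCoeff_mul_conj] at e
  have d0 := congrArg Complex.im (h.conj_particle 0 0)
  have d1 := congrArg Complex.im (h.conj_particle 1 1)
  -- Adding the `xx` and `pp` entries cancels the anomalous part and yields the real parts of `r_α`.
  -- The difference of the `x₁p₂` and `p₁x₂` entries gives `Im (r_α)₁₂ = 0`, while `d0` and `d1`
  -- give real diagonals.
  have e00 := e 0 0
  have e11 := e 1 1
  have e22 := e 2 2
  have e33 := e 3 3
  have e02 := e 0 2
  have e13 := e 1 3
  have e03 := e 0 3
  have e12 := e 1 2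
  simp [standardForm, quadratureMode] at e00 e11 e22 e33 e02 e13 e03 e12 d0 d1
  refine ⟨Complex.ext ?_ ?_, Complex.ext ?_ ?_, Complex.ext ?_ ?_⟩ <;> simp <;> linarith

/-- Without centred anomalous moments positions and momenta are correlated equally, which forces `c₊
= c₋`. -/
theorem covarianceMatrix_eq_standardForm {σ : FockSpace →L[ℂ] FockSpace} {α : Fin 2 → ℂ}
    {r s : Matrix (Fin 2) (Fin 2) ℂ} (h : LadderMoments σ α r s)
    (hs : ∀ k k', s k k' = α k * α k') {a b c : ℝ}
    (h00 : r 0 0 - α 0 * conj (α 0) = ((a - 1 / 2 : ℝ) : ℂ))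
    (h11 : r 1 1 - α 1 * conj (α 1) = ((b - 1 / 2 : ℝ) : ℂ))
    (h01 : r 0 1 - α 0 * conj (α 1) = (c : ℂ)) :
    covarianceMatrix σ = standardForm a b c c := by
  have h10 : r 1 0 - α 1 * conj (α 0) = (c : ℂ) := by
    have := congrArg conj h01
    rw [map_sub, map_mul, h.conj_particle, Complex.conj_conj, Complex.conj_ofReal] at this
    rw [← this, mul_comm]
  ext l m
  rw [h.covarianceMatrix_apply, hs, sub_self, mul_zero, zero_add, quadratureCoeff_mul_conj]
  fin_cases l <;> fin_cases m <;>
    simp [quadratureMode, standardForm, h00, h11, h01, h10]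

end BosonField

end

open BosonField
theorem proposition5 (ρ : FockSpace →L[ℂ] FockSpace) (hρ : IsGaussian ρ) :
    (∃ σ : FockSpace →L[ℂ] FockSpace,
      IsGaussian σ ∧ IsSeparableState σ ∧ rsf σ = rsf ρ) ∧
    (∀ a b cp cm : ℝ, covarianceMatrix ρ = standardForm a b cp cm →
      ∃ c : ℝ, correlationMatrix ρ 0 1 = (c : ℂ) ∧
        ∃ σ : FockSpace →L[ℂ] FockSpace,
          IsGaussian σ ∧ IsSeparableState σ ∧ rsf σ = rsf ρ ∧
            covarianceMatrix σ = standardForm a b c c) := by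
  obtain ⟨α, r, s, h⟩ := exists_ladderMoments hρ.1 hρ.2.1
  obtain ⟨C, hC⟩ := exists_conjTranspose_mul_self_eq (h.posSemidef hρ.1.1)
  -- With `B = Cᴴ` the classical covariance `B Bᴴ = Cᴴ C` is exactly `r_α`.
  have hσ := ladderMoments_complexGaussian α C.conjTranspose
  have hr : (Matrix.of fun k k' => α k * star (α k') +
      (C.conjTranspose * C.conjTranspose.conjTranspose) k k' : Matrix _ _ ℂ) = r := by
    ext k k'
    rw [Matrix.conjTranspose_conjTranspose, ← hC]
    simp
  change LadderMoments _ α (Matrix.of fun k k' => α k * star (α k') + _) _ at hσ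
  rw [hr] at hσ
  have hG := isGaussian_complexGaussian α C.conjTranspose
  have hS := isSeparableState_coherentMixture (ν := complexGaussian α C.conjTranspose)
  have hrsf := hσ.rsf_eq.trans h.rsf_eq.symm
  refine ⟨⟨_, hG, hS, hrsf⟩, fun a b cp cm hV => ?_⟩
  obtain ⟨h00, h11, h01⟩ := h.of_standardForm hV
  exact ⟨_, (h.correlationMatrix_apply 0 1).trans h01, _, hG, hS, hrsf,
    covarianceMatrix_eq_standardForm hσ (fun _ _ => rfl) h00 h11 h01⟩
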